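/- Let $N\in\mathbb N$, $a\ge 0$, $b>0$, and put $\alpha:=a+b-1$, $\beta:=b-1$ (so $\alpha,\beta>-1$). For $\kappa>0$ let $\tilde\mu_\kappa$ be the probability measure (the $\beta$-Jacobi ensemble with parameters $\kappa\cdot(a,b,1)$ in trigonometric coordinates) on the alcove $$\tilde A:=\{t\in\mathbb R^N : \tfrac{\pi}{2}\ge t_1\ge\dots\ge t_N\ge 0\}$$ with Lebesgue density $$\tilde c_\kappa\prod_{1\le i<j\le N}\bigl(\cos(2t_j)-\cos(2t_i)\bigr)^{\kappa}\prod_{i=1}^N \sin(t_i)^{\kappa a}\sin(2t_i)^{\kappa b},$$ where $\tilde c_\kappa>0$ is the normalizing constant, and let $\tilde X_\kappa$ be random variables with distributions $\tilde\mu_\kappa$. The Jacobi polynomial $$P_N^{(\alpha,\beta)}(x)=\sum_{k=0}^N\frac{(N+\alpha+\beta+1)_k\,(\alpha+k+1)_{N-k}}{k!\,(N-k)!}\Bigl(\frac{x-1}{2}\Bigr)^k,\qquad (y)_m:=y(y+1)\cdots(y+m-1),$$ has $N$ simple zeros $-1<z_1<\dots<z_N<1$. Put $z:=(z_1,\dots,z_N)$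 and $T^{-1}(z):=(\tfrac12\arccos z_1,\dots,\tfrac12\arccos z_N)$. Then, as $\kappa\to\infty$, $\sqrt\kappa\,(\tilde X_\kappa-T^{-1}(z))$ converges in distribution to the centered normal distribution $N(0,\tilde\Sigma)$ on $\mathbb R^N$ whose covariance matrix $\tilde\Sigma$ is the inverse of the positive definite matrix $\tilde S=(\tilde s_{i,j})_{i,j=1,\dots,N}$ with $$\tilde s_{i,j}=\begin{cases}\displaystyle 4\sum_{l\ne j}\frac{1-z_j^2}{(z_j-z_l)^2}+2(a+b)\frac{1+z_j}{1-z_j}+2b\,\frac{1-z_j}{1+z_j} & \text{for } i=j,\\[2ex] \displaystyle\frac{-4\sqrt{(1-z_j^2)(1-z_i^2)}}{(z_i-z_j)^2} & \text{for } i\ne j.\end{cases}$$ Furthermore, the eigenvalues of $\tilde S=\tilde\Sigma^{-1}$ are simple and given by $$\lambda_k=2k(2N+\alpha+\beta+1-k)>0\qquad(k=1,\dots,N),$$ and there are polynomials $q_0,\dots,q_{N-1}$, where $q_k$ has degree $k$, which are orthonormal with respect to the discrete measure $\mu_{N,\alpha,\beta}:=\sum_{i=1}^N(1-z_i^2)\,\delta_{z_i}$,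 such that for $k=1,\dots,N$ the vector $$v_k:=\Bigl(q_{k-1}(z_1)\sqrt{1-z_1^2},\dots,q_{k-1}(z_N)\sqrt{1-z_N^2}\Bigr)^T$$ is an eigenvector of $\tilde S$ for the eigenvalue $\lambda_k$. -/

import Mathlib

open MeasureTheory ProbabilityTheory Filter Topology Polynomial
open scoped Matrix

noncomputable section

namespace BetaJacobi

/-- The trigonometric alcove `{t ∈ ℝᴺ | π/2 ≥ t₁ ≥ ⋯ ≥ t_N ≥ 0}`. -/
def trigAlcove (N : ℕ) : Set (EuclideanSpace ℝ (Fin N)) :=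
  {t | (∀ i, 0 ≤ t i ∧ t i ≤ Real.pi / 2) ∧ Antitone (fun i => t i)}

/-- The unnormalized density
`∏_{i<j} (cos 2t_j - cos 2t_i)^k₃ ∏_i sin(t_i)^k₁ sin(2t_i)^k₂`, used on `trigAlcove N` only,
where all bases are nonnegative. -/
def trigWeight {N : ℕ} (k₁ k₂ k₃ : ℝ) (t : EuclideanSpace ℝ (Fin N)) : ℝ :=
  (∏ i : Fin N, ∏ j ∈ Finset.Ioi i, (Real.cos (2 * t j) - Real.cos (2 * t i)) ^ k₃) *
    ∏ i : Fin N, (Real.sin (t i) ^ k₁ * Real.sin (2 * t i) ^ k₂)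

/-- The measure on `ℝᴺ` with Lebesgue density `trigWeight k₁ k₂ k₃` on the alcove and `0`
elsewhere. -/
def trigUnnormalized (N : ℕ) (k₁ k₂ k₃ : ℝ) : Measure (EuclideanSpace ℝ (Fin N)) :=
  (volume.restrict (trigAlcove N)).withDensity fun t => ENNReal.ofReal (trigWeight k₁ k₂ k₃ t)

/-- The β-Jacobi ensemble with parameters `(k₁, k₂, k₃)` in trigonometric coordinates: the
normalization of `trigUnnormalized` to a probability measure. -/
def trigJacobiEnsemble (N : ℕ) (k₁ k₂ k₃ : ℝ) : Measure (EuclideanSpace ℝ (Fin N)) :=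
  (trigUnnormalized N k₁ k₂ k₃ Set.univ)⁻¹ • trigUnnormalized N k₁ k₂ k₃

/-- The Jacobi polynomial
`P_n^{(α,β)}(x) = ∑_{k=0}^n (n+α+β+1)_k (α+k+1)_{n-k} / (k! (n-k)!) ((x-1)/2)^k`
`= (α+1)_n / n! · ₂F₁(-n, n+α+β+1; α+1; (1-x)/2)`,
where `(y)_m = y (y+1) ⋯ (y+m-1)`; orthogonal on `(-1,1)` for the weight `(1-x)^α (1+x)^β`. -/
def jacobiPolynomial (n : ℕ) (α β : ℝ) : ℝ[X] :=
  ∑ k ∈ Finset.range (n + 1),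
    C ((ascPochhammer ℝ k).eval (n + α + β + 1) * (ascPochhammer ℝ (n - k)).eval (α + k + 1) /
        ((k.factorial : ℝ) * ((n - k).factorial : ℝ))) *
      (C (1 / 2) * (X - 1)) ^ k

/-- The point `T⁻¹(z) = (½ arccos z₁, …, ½ arccos z_N)`, where
`T(t) = (cos 2t₁, …, cos 2t_N)` on the trigonometric alcove. -/
def trigPoint {N : ℕ} (z : Fin N → ℝ) : EuclideanSpace ℝ (Fin N) :=
  WithLp.toLp 2 fun i => Real.arccos (z i) / 2

/-- The matrix `S̃` (inverse of the limiting covariance matrix). -/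
def invCov {N : ℕ} (a b : ℝ) (z : Fin N → ℝ) : Matrix (Fin N) (Fin N) ℝ :=
  Matrix.of fun i j =>
    if i = j then
      4 * ∑ l ∈ Finset.univ.erase j, (1 - z j ^ 2) / (z j - z l) ^ 2 +
        2 * (a + b) * ((1 + z j) / (1 - z j)) + 2 * b * ((1 - z j) / (1 + z j))
    else
      -4 * √((1 - z j ^ 2) * (1 - z i ^ 2)) / (z i - z j) ^ 2

/-- `λ_k = 2k(2N + α + β + 1 - k)`. -/
def eigenvalue (N : ℕ) (α β : ℝ) (k : ℕ) : ℝ := 2 * k * (2 * N + α + β + 1 - k)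

/-- The discrete measure `∑ᵢ (1 - zᵢ²) δ_{zᵢ}` on `ℝ`. -/
def discreteMeasure {N : ℕ} (z : Fin N → ℝ) : Measure ℝ :=
  ∑ i, ENNReal.ofReal (1 - z i ^ 2) • Measure.dirac (z i)

/-- The vector `(q(z₁) √(1 - z₁²), …, q(z_N) √(1 - z_N²))`. -/
def eigenvec {N : ℕ} (z : Fin N → ℝ) (q : ℝ[X]) : Fin N → ℝ :=
  fun i => q.eval (z i) * √(1 - z i ^ 2)

end BetaJacobi

end

/-! On the alcove the density with parameters `κ * a`, `κ * b`, `κ` is the `κ`-th power of the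
weight with `κ = 1`, so the limit theorem is Laplace's method. Since cos 2t_j - cos 2t_i = 2 sin(t_i
+ t_j) sin(t_i - t_j), the logarithm of that weight is, up to a constant, a nonnegative combination
of log sin of linear forms with values in (0, π). There (log sin)'' = -1/sin² ≤ -1, so it is
strongly concave (`log_sin_le`, `logWeight_le`). The weight vanishes on the walls, hence compactness
gives an interior critical point t₀ (`exists_critical_point`). Strong concavity bounds the rescaled
density by one Gaussian for all `κ`, the second-order expansion gives its pointwise limit, and
dominated convergence concludes (`tendsto_integral_trigJacobiEnsemble`).

The zeros of the Jacobi polynomial are not constructed directly: z is taken to be cos 2t₀.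
Criticality of t₀ is Stieltjes' electrostatic equilibrium for z (`stieltjes_of_critical`). It says
that ∏(x - z_l) solves the hypergeometric equation, whose power series solution is unique up to a
factor, so this product is a multiple of the Jacobi polynomial (`jacobiPolynomial_roots`). The same
relations turn the Hessian at t₀ into the matrix S̃ (`logWeightQuad_eq_invCov`), which gives
positive definiteness.

For the spectrum, S̃ is read as an operator on polynomials sampled at the nodes with factor √(1 -
z_i²). By the Stieltjes relations it sends x^m to λ_{m+1} x^m plus lower order terms. The λ_k are
distinct, so the triangular system yields an eigenpolynomial in each degree; symmetry of S̃ makes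
these orthogonal, and N distinct eigenvalues exhaust the characteristic polynomial. -/

namespace BetaJacobi

/-! ### The hypergeometric equation and its polynomial solutions. -/

section Hypergeometric

/-- The hypergeometric differential operator
`y(1+y) P'' + (c + d y) P' - e P`, whose polynomial solutions are the Jacobi polynomials in the
variable `y = (x - 1) / 2`. -/
noncomputable def hypOp (c d e : ℝ) (P : ℝ[X]) : ℝ[X] :=
  X * derivative (derivative P) + X * (X * derivative (derivative P)) +
    (C c * derivative P + C d * (X * derivative P)) - C e * P

theorem coeff_X_mul_derivative (P : ℝ[X]) (k : ℕ) :
    (X * derivative P).coeff k = k * P.coeff k := by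
  cases k with
  | zero => simp
  | succ k => rw [coeff_X_mul, coeff_derivative]; push_cast; ring

theorem X_mul_X_mul_derivative_derivative (P : ℝ[X]) :
    X * (X * derivative (derivative P)) = X * derivative (X * derivative P) - X * derivative P := by
  simp only [derivative_mul, derivative_X]; ring

theorem coeff_hypOp (c d e : ℝ) (P : ℝ[X]) (k : ℕ) :
    (hypOp c d e P).coeff k =
      (k + 1) * (k + c) * P.coeff (k + 1) + (k * (k - 1) + d * k - e) * P.coeff k := by
  rw [hypOp, X_mul_X_mul_derivative_derivative]
  simp only [coeff_add, coeff_sub, coeff_C_mul, coeff_X_mul_derivative, coeff_derivative]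
  ring

/-- The equation is a two-term recursion for the coefficients, and c > 0 keeps the factor (k + 1)(k
+ c) of the next coefficient nonzero; the constant term therefore determines the solution. -/
theorem eq_smul_of_hypOp_eq_zero {c d e : ℝ} (hc : 0 < c) {P Q : ℝ[X]}
    (hP : hypOp c d e P = 0) (hQ : hypOp c d e Q = 0) (hQ0 : Q.coeff 0 ≠ 0) :
    P = C (P.coeff 0 / Q.coeff 0) * Q := by
  ext k
  rw [coeff_C_mul]
  induction k with
  | zero => field_simp
  | succ k ih =>
    have h1 := congrArg (fun p => p.coeff k) hP
    have h2 := congrArg (fun p => p.coeff k) hQ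
    simp only [coeff_hypOp, coeff_zero] at h1 h2
    have hk : ((k : ℝ) + 1) * (k + c) ≠ 0 := by positivity
    apply mul_left_cancel₀ hk
    rw [ih] at h1
    linear_combination h1 - P.coeff 0 / Q.coeff 0 * h2

/-- The Jacobi polynomial in the variable `(x - 1) / 2`. -/
noncomputable def jacobiHyp (n : ℕ) (α β : ℝ) : ℝ[X] :=
  ∑ k ∈ Finset.range (n + 1),
    C ((ascPochhammer ℝ k).eval (n + α + β + 1) * (ascPochhammer ℝ (n - k)).eval (α + k + 1) /
        ((k.factorial : ℝ) * ((n - k).factorial : ℝ))) * X ^ k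

theorem jacobiPolynomial_eq_comp (n : ℕ) (α β : ℝ) :
    jacobiPolynomial n α β = (jacobiHyp n α β).comp (C (1 / 2) * (X - 1)) := by
  simp [jacobiPolynomial, jacobiHyp, Polynomial.sum_comp]

theorem coeff_jacobiHyp (n : ℕ) (α β : ℝ) (k : ℕ) :
    (jacobiHyp n α β).coeff k = if k ≤ n then
      (ascPochhammer ℝ k).eval (n + α + β + 1) * (ascPochhammer ℝ (n - k)).eval (α + k + 1) /
        ((k.factorial : ℝ) * ((n - k).factorial : ℝ)) else 0 := by
  simp [jacobiHyp, finsetSum_coeff, coeff_X_pow]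

theorem eval_ascPochhammer_succ_left (n : ℕ) (x : ℝ) :
    (ascPochhammer ℝ (n + 1)).eval x = x * (ascPochhammer ℝ n).eval (x + 1) := by
  simp [ascPochhammer_succ_left]

theorem hypOp_jacobiHyp (n : ℕ) (α β : ℝ) :
    hypOp (α + 1) (α + β + 2) (n * (n + α + β + 1)) (jacobiHyp n α β) = 0 := by
  ext k
  rw [coeff_hypOp, coeff_zero]
  rcases lt_trichotomy k n with h | h | h
  -- With n = k + 1 + m no truncated subtraction remains; passing from k to k + 1 appends a last
  -- factor to one Pochhammer symbol and removes the first factor of the other.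
  · obtain ⟨m, rfl⟩ : ∃ m, n = k + 1 + m := ⟨n - (k + 1), by omega⟩
    rw [coeff_jacobiHyp, coeff_jacobiHyp, if_pos (by omega), if_pos (by omega),
      show k + 1 + m - (k + 1) = m by omega, show k + 1 + m - k = m + 1 by omega,
      ascPochhammer_succ_eval, eval_ascPochhammer_succ_left m]
    rw [Nat.factorial_succ, Nat.factorial_succ]
    push_cast
    have e1 : α + (k : ℝ) + 1 + 1 = α + (k + 1) + 1 := by ring
    rw [e1]
    have h1 : (k.factorial : ℝ) ≠ 0 := by positivity
    have h2 : (m.factorial : ℝ) ≠ 0 := by positivity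
    field_simp
    ring
  · subst h
    rw [coeff_jacobiHyp, if_neg (by omega)]
    ring
  · rw [coeff_jacobiHyp, coeff_jacobiHyp, if_neg (by omega), if_neg (by omega)]
    ring

theorem coeff_zero_jacobiHyp_pos (n : ℕ) {α : ℝ} (β : ℝ) (hα : -1 < α) :
    0 < (jacobiHyp n α β).coeff 0 := by
  rw [coeff_jacobiHyp, if_pos (Nat.zero_le _)]
  have := ascPochhammer_pos (S := ℝ) n (α + 1) (by linarith)
  simp only [ascPochhammer_zero, eval_one, Nat.cast_zero, add_zero, Nat.sub_zero,
    Nat.factorial_zero, Nat.cast_one, one_mul]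
  positivity

end Hypergeometric

/-! ### Stieltjes equilibrium and the zeros of Jacobi polynomials. -/

section Electrostatic

theorem eval_derivative_prod_X_sub_C {ι : Type*} [DecidableEq ι] (s : Finset ι) (y : ι → ℝ) (x : ℝ)
    (h : ∀ l ∈ s, x - y l ≠ 0) :
    (derivative (∏ l ∈ s, (X - C (y l)))).eval x =
      (∏ l ∈ s, (x - y l)) * ∑ l ∈ s, 1 / (x - y l) := by
  rw [derivative_prod_finset, eval_finsetSum, Finset.mul_sum]
  refine Finset.sum_congr rfl fun l hl => ?_
  rw [eval_mul, eval_prod, ← Finset.mul_prod_erase s _ hl]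
  have := h l hl
  simp
  field_simp

variable {ι : Type*} [Fintype ι] [DecidableEq ι]

theorem prod_X_sub_C_eq (y : ι → ℝ) (i : ι) :
    ∏ l, (X - C (y l)) = (X - C (y i)) * ∏ l ∈ Finset.univ.erase i, (X - C (y l)) :=
  (Finset.mul_prod_erase Finset.univ (fun l => X - C (y l)) (Finset.mem_univ i)).symm

/-- Writing P = (X - y_i) r gives P(y_i) = 0, P'(y_i) = r(y_i) and P''(y_i) = 2 r'(y_i), and r'/r is
a sum of simple fractions. -/
theorem eval_hypOp_prod (c d e : ℝ) {y : ι → ℝ} (hy : Function.Injective y) (i : ι) :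
    (hypOp c d e (∏ l, (X - C (y l)))).eval (y i) =
      (∏ l ∈ Finset.univ.erase i, (y i - y l)) *
        (y i * (1 + y i) * (2 * ∑ l ∈ Finset.univ.erase i, 1 / (y i - y l)) + (c + d * y i)) := by
  have hne : ∀ l ∈ Finset.univ.erase i, y i - y l ≠ 0 := fun l hl =>
    sub_ne_zero.2 fun h => (Finset.ne_of_mem_erase hl) (hy h).symm
  have h1 := eval_derivative_prod_X_sub_C _ y (y i) hne
  rw [prod_X_sub_C_eq y i]
  have h2 : (∏ l ∈ Finset.univ.erase i, (X - C (y l))).eval (y i) =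
      ∏ l ∈ Finset.univ.erase i, (y i - y l) := by simp [eval_prod]
  generalize (∏ l ∈ Finset.univ.erase i, (X - C (y l))) = r at *
  rw [← h2] at h1 ⊢
  simp only [hypOp, derivative_mul, derivative_sub, derivative_X, derivative_C, eval_add, eval_mul,
    eval_sub, eval_X, eval_C, derivative_add, sub_zero,
    sub_self, zero_mul, one_mul, add_zero, h1]
  ring

/-- The value of e cancels the top coefficient, so the image has degree below the number of nodes,
while equilibrium makes it vanish at all of them. -/
theorem hypOp_prod_eq_zero {c d e : ℝ} {y : ι → ℝ} (hy : Function.Injective y)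
    (hcrit : ∀ i, y i * (1 + y i) * (2 * ∑ l ∈ Finset.univ.erase i, 1 / (y i - y l)) +
      (c + d * y i) = 0)
    (he : e = Fintype.card ι * (Fintype.card ι - 1 + d)) :
    hypOp c d e (∏ l, (X - C (y l))) = 0 := by
  set P : ℝ[X] := ∏ l, (X - C (y l)) with hP
  have hmonic : P.Monic := monic_prod_of_monic _ _ fun l _ => monic_X_sub_C _
  have hdeg : P.natDegree = Fintype.card ι := by
    rw [hP, natDegree_prod_of_monic _ _ fun l _ => monic_X_sub_C _]; simp
  set T := Finset.univ.image y with hT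
  refine eq_zero_of_degree_lt_of_eval_finset_eq_zero T ?_ ?_
  · rw [hT, Finset.card_image_of_injective _ hy, Finset.card_univ, degree_lt_iff_coeff_zero]
    intro k hk
    rw [coeff_hypOp, coeff_eq_zero_of_natDegree_lt (n := k + 1) (by omega)]
    rcases hk.eq_or_lt with h | h
    · rw [he, h]; ring
    · rw [coeff_eq_zero_of_natDegree_lt (by omega)]; ring
  · intro x hx
    obtain ⟨i, -, rfl⟩ := Finset.mem_image.1 hx
    rw [eval_hypOp_prod _ _ _ hy, hcrit i, mul_zero]

/-- A configuration in electrostatic equilibrium (Stieltjes) is the zero set of a Jacobi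
polynomial. -/
theorem jacobiPolynomial_roots {N : ℕ} {α β : ℝ} (hα : -1 < α) {z : Fin N → ℝ}
    (hz : Function.Injective z) (hmem : ∀ i, z i ∈ Set.Ioo (-1 : ℝ) 1)
    (hcrit : ∀ i, ∑ l ∈ Finset.univ.erase i, 2 / (z i - z l) =
      (α + 1) / (1 - z i) - (β + 1) / (1 + z i)) :
    (jacobiPolynomial N α β).roots = Finset.univ.val.map z := by
  set y : Fin N → ℝ := fun i => (z i - 1) / 2 with hy
  have hyinj : Function.Injective y := fun i j h => hz (by simp only [hy] at h; linarith)
  have hode : hypOp (α + 1) (α + β + 2) (N * (N + α + β + 1)) (∏ l, (X - C (y l))) = 0 := by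
    refine hypOp_prod_eq_zero hyinj (fun i => ?_) (by rw [Fintype.card_fin]; ring)
    have h1 : 2 * ∑ l ∈ Finset.univ.erase i, 1 / (y i - y l) =
        2 * ∑ l ∈ Finset.univ.erase i, 2 / (z i - z l) := by
      congr 1
      refine Finset.sum_congr rfl fun l _ => ?_
      rw [show y i - y l = (z i - z l) / 2 by simp only [hy]; ring, one_div_div]
    rw [h1, hcrit i]
    have h2 : 1 - z i ≠ 0 := by linarith [(hmem i).2]
    have h3 : 1 + z i ≠ 0 := by linarith [(hmem i).1]
    simp only [hy]
    field_simp
    ring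
  have hJ0 := coeff_zero_jacobiHyp_pos N β hα
  have key := eq_smul_of_hypOp_eq_zero (by linarith) hode (hypOp_jacobiHyp N α β) hJ0.ne'
  set c := (∏ l, (X - C (y l))).coeff 0 / (jacobiHyp N α β).coeff 0 with hcdef
  have hc : c ≠ 0 := by
    intro h
    rw [h, map_zero, zero_mul] at key
    exact (monic_prod_of_monic _ _ fun l _ => monic_X_sub_C (y l)).ne_zero key
  -- Substituting (x - 1)/2 turns each factor X - y_l into half of X - z_l, whence the power of 2.
  have hcomp : C (c * 2 ^ N) * jacobiPolynomial N α β = ∏ l, (X - C (z l)) := by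
    have h2 := congrArg (fun p => C ((2 : ℝ) ^ N) * p.comp (C (1 / 2) * (X - 1))) key
    simp only [prod_comp, mul_comp, C_comp, sub_comp, X_comp, ← jacobiPolynomial_eq_comp] at h2
    rw [map_mul, mul_comm (C c), mul_assoc, ← h2]
    rw [show C ((2 : ℝ) ^ N) = ∏ _l : Fin N, C 2 by simp, ← Finset.prod_mul_distrib]
    refine Finset.prod_congr rfl fun l _ => ?_
    rw [mul_sub, ← mul_assoc, ← C_mul, ← C_mul, show (2 : ℝ) * (1 / 2) = 1 by norm_num,
      show 2 * y l = z l - 1 by simp only [hy]; ring]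
    simp
  rw [← roots_C_mul _ (mul_ne_zero hc (pow_ne_zero N two_ne_zero)), hcomp]
  rw [roots_prod _ _ (Finset.prod_ne_zero_iff.2 fun l _ => X_sub_C_ne_zero _)]
  simp [Multiset.bind_singleton]

end Electrostatic

end BetaJacobi

namespace BetaJacobi

/-! ### Second-order remainders of monomials. -/

section DividedDifference

/-- The polynomial `H` in `y` with `x ^ n - y ^ n = n y ^ (n - 1) (x - y) + (x - y) ^ 2 H(y)`. -/
noncomputable def powRemainder (x : ℝ) : ℕ → ℝ[X]
  | 0 => 0
  | n + 1 => C x * powRemainder x n + C (n : ℝ) * X ^ (n - 1)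

theorem powRemainder_spec (x y : ℝ) (n : ℕ) :
    x ^ n - y ^ n = n * y ^ (n - 1) * (x - y) + (x - y) ^ 2 * (powRemainder x n).eval y := by
  induction n with
  | zero => simp [powRemainder]
  | succ n ih =>
    simp only [powRemainder, eval_add, eval_mul, eval_C, eval_pow, eval_X, Nat.add_sub_cancel]
    cases n with
    | zero => simp [powRemainder]
    | succ n =>
      simp only [Nat.add_sub_cancel] at ih ⊢
      push_cast at ih ⊢
      linear_combination x * ih

/-- On the diagonal the remainder is half the second derivative. This is the term l = i by which a
sum over all nodes exceeds the sum over l ≠ i. -/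
theorem powRemainder_eval_self (y : ℝ) (n : ℕ) :
    2 * (powRemainder y n).eval y = n * (n - 1) * y ^ (n - 2) := by
  induction n with
  | zero => simp [powRemainder]
  | succ n ih =>
    simp only [powRemainder, eval_add, eval_mul, eval_C, eval_pow, eval_X]
    rcases n with _ | _ | n
    · simp [powRemainder]
    · norm_num [powRemainder]
    · simp only [show n + 1 + 1 + 1 - 2 = n + 1 by omega, show n + 1 + 1 - 1 = n + 1 by omega,
        show n + 1 + 1 - 2 = n by omega] at ih ⊢
      push_cast at ih ⊢
      linear_combination y * ih

theorem coeff_powRemainder_of_le (x : ℝ) (n k : ℕ) (h : n ≤ k + 1) :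
    (powRemainder x n).coeff k = 0 := by
  induction n with
  | zero => simp [powRemainder]
  | succ n ih =>
    rw [powRemainder, coeff_add, coeff_C_mul, coeff_C_mul, ih (by omega), coeff_X_pow]
    rcases n with _ | n
    · simp
    · rw [if_neg (by omega)]; ring

theorem coeff_powRemainder (x : ℝ) (m : ℕ) : (powRemainder x (m + 2)).coeff m = m + 1 := by
  rw [powRemainder, coeff_add, coeff_C_mul, coeff_powRemainder_of_le _ _ _ le_rfl,
    coeff_C_mul, coeff_X_pow]
  simp

end DividedDifference

/-! ### The matrix as a triangular operator on polynomials. -/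

section Operator

variable {N : ℕ}

theorem eigenvec_add (z : Fin N → ℝ) (p q : ℝ[X]) :
    eigenvec z (p + q) = eigenvec z p + eigenvec z q := by
  ext i; simp [eigenvec, add_mul]

theorem eigenvec_C_mul (z : Fin N → ℝ) (c : ℝ) (q : ℝ[X]) :
    eigenvec z (C c * q) = c • eigenvec z q := by
  ext i; simp [eigenvec, mul_assoc]

theorem invCov_isSymm (a b : ℝ) (z : Fin N → ℝ) : (invCov a b z).IsSymm := by
  ext i j
  simp only [Matrix.transpose_apply, invCov, Matrix.of_apply]
  by_cases h : i = j
  · subst h; rfl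
  · rw [if_neg h, if_neg (Ne.symm h), mul_comm (1 - z i ^ 2), ← neg_sub (z i), neg_sq]

/-- The sum in the diagonal entry combines with the off-diagonal entries into differences of the
single function (1 - w²) q(w), which makes a Taylor expansion at z_i possible. -/
theorem invCov_mulVec_eigenvec (a b : ℝ) {z : Fin N → ℝ} (hmem : ∀ i, z i ∈ Set.Ioo (-1 : ℝ) 1)
    (q : ℝ[X]) (i : Fin N) :
    (invCov a b z *ᵥ eigenvec z q) i = √(1 - z i ^ 2) *
      (∑ l ∈ Finset.univ.erase i, 4 * ((1 - z i ^ 2) * q.eval (z i) - (1 - z l ^ 2) * q.eval (z l)) /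
          (z i - z l) ^ 2 +
        (2 * (a + b) * ((1 + z i) / (1 - z i)) + 2 * b * ((1 - z i) / (1 + z i))) *
          q.eval (z i)) := by
  have hpos : ∀ l, 0 ≤ 1 - z l ^ 2 := fun l => by nlinarith [(hmem l).1, (hmem l).2]
  rw [Matrix.mulVec, dotProduct, ← Finset.add_sum_erase _ _ (Finset.mem_univ i)]
  have h1 : ∀ l ∈ Finset.univ.erase i, invCov a b z i l * eigenvec z q l =
      √(1 - z i ^ 2) * (-(4 * ((1 - z l ^ 2) * q.eval (z l)) / (z i - z l) ^ 2)) := by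
    intro l hl
    have hne : i ≠ l := (Finset.ne_of_mem_erase hl).symm
    simp only [invCov, Matrix.of_apply, if_neg hne, eigenvec]
    rw [Real.sqrt_mul (hpos l)]
    have := Real.mul_self_sqrt (hpos l)
    linear_combination (-4 * √(1 - z i ^ 2) * eval (z l) q / (z i - z l) ^ 2) * this
  rw [Finset.sum_congr rfl h1]
  simp only [invCov, Matrix.of_apply, if_true, eigenvec]
  rw [← Finset.mul_sum]
  have h2 : ∑ l ∈ Finset.univ.erase i,
      4 * ((1 - z i ^ 2) * q.eval (z i) - (1 - z l ^ 2) * q.eval (z l)) / (z i - z l) ^ 2 =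
      4 * (∑ l ∈ Finset.univ.erase i, (1 - z i ^ 2) / (z i - z l) ^ 2) * q.eval (z i) +
      ∑ l ∈ Finset.univ.erase i, -(4 * ((1 - z l ^ 2) * q.eval (z l)) / (z i - z l) ^ 2) := by
    rw [Finset.mul_sum, Finset.sum_mul, ← Finset.sum_add_distrib]
    refine Finset.sum_congr rfl fun l _ => ?_
    ring
  rw [h2]
  ring

/-- The polynomial whose values at the `z i` give the action of `invCov` on `X ^ m`. -/
noncomputable def invCovPow (a b : ℝ) (z : Fin N → ℝ) (m : ℕ) : ℝ[X] :=
  C (2 * m * a) * X ^ (m - 1) + C (2 * (m + 1) * (a + 2 * b)) * X ^ m +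
    C (2 * (m * (m - 1) : ℝ)) * X ^ (m - 2) - C (2 * ((m + 2) * (m + 1) : ℝ)) * X ^ m -
    C 4 * ∑ l, (powRemainder (z l) m - powRemainder (z l) (m + 2))

/-- Expanding w^m - w^(m+2) at z_i, the first-order part is summed over l by the Stieltjes relation
and the second-order part is already polynomial in z_i. -/
theorem invCov_mulVec_eigenvec_pow {a b : ℝ} {z : Fin N → ℝ} (hz : Function.Injective z)
    (hmem : ∀ i, z i ∈ Set.Ioo (-1 : ℝ) 1)
    (hcrit : ∀ i, ∑ l ∈ Finset.univ.erase i, 2 / (z i - z l) =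
      (a + b) / (1 - z i) - b / (1 + z i)) (m : ℕ) :
    invCov a b z *ᵥ eigenvec z (X ^ m) = eigenvec z (invCovPow a b z m) := by
  ext i
  rw [invCov_mulVec_eigenvec a b hmem, eigenvec, mul_comm]
  congr 1
  set y := z i with hy
  have h1y : 1 - y ≠ 0 := by linarith [(hmem i).2]
  have h2y : 1 + y ≠ 0 := by linarith [(hmem i).1]
  have hterm : ∀ l ∈ Finset.univ.erase i,
      4 * ((1 - y ^ 2) * (X ^ m : ℝ[X]).eval y - (1 - z l ^ 2) * (X ^ m : ℝ[X]).eval (z l)) /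
        (y - z l) ^ 2 =
      2 * (m * y ^ (m - 1) - (m + 2) * y ^ (m + 1)) * (2 / (y - z l)) -
        4 * ((powRemainder (z l) m).eval y - (powRemainder (z l) (m + 2)).eval y) := by
    intro l hl
    have hne : y - z l ≠ 0 := sub_ne_zero.2 fun h => (Finset.ne_of_mem_erase hl) (hz h).symm
    have e1 := powRemainder_spec (z l) y m
    have e2 := powRemainder_spec (z l) y (m + 2)
    rw [show m + 2 - 1 = m + 1 by omega] at e2
    push_cast at e2
    rw [eval_pow, eval_pow, eval_X, eval_X]
    field_simp
    linear_combination -4 * e1 + 4 * e2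
  rw [Finset.sum_congr rfl hterm, Finset.sum_sub_distrib, ← Finset.mul_sum, hcrit i,
    ← Finset.mul_sum]
  have hself1 := powRemainder_eval_self y m
  have hself2 := powRemainder_eval_self y (m + 2)
  rw [Nat.add_sub_cancel] at hself2
  push_cast at hself2
  have hsplit := Finset.add_sum_erase Finset.univ
    (fun l => (powRemainder (z l) m).eval y - (powRemainder (z l) (m + 2)).eval y)
    (Finset.mem_univ i)
  simp only [← hy] at hsplit
  simp only [invCovPow, eval_add, eval_sub, eval_mul, eval_C, eval_pow, eval_X, eval_finsetSum]
  rw [← hsplit]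
  -- The poles at y = ±1 coming from the Stieltjes relation cancel those of the diagonal entry of
  -- the matrix, leaving a polynomial.
  have hmain : 2 * (m * y ^ (m - 1) - (m + 2) * y ^ (m + 1)) * ((a + b) / (1 - y) - b / (1 + y)) +
      (2 * (a + b) * ((1 + y) / (1 - y)) + 2 * b * ((1 - y) / (1 + y))) * y ^ m =
      2 * m * a * y ^ (m - 1) + 2 * (m + 1) * (a + 2 * b) * y ^ m := by
    rcases m with _ | m
    · simp only [Nat.cast_zero, zero_add]
      field_simp
      ring
    · rw [Nat.add_sub_cancel]
      push_cast
      field_simp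
      ring
  linear_combination hmain + 2 * hself1 - 2 * hself2

/-- The leading coefficient is 2(m+1)(a+2b) - 2(m+2)(m+1) + 4N(m+1); the last term comes from the N
remainders of x^(m+2), each with leading coefficient m + 1. -/
theorem coeff_invCovPow (a b : ℝ) (z : Fin N → ℝ) (m k : ℕ) (h : m ≤ k) :
    (invCovPow a b z m).coeff k =
      if k = m then eigenvalue N (a + b - 1) (b - 1) (m + 1) else 0 := by
  -- At m = 0 the truncated exponent m - 1 equals m, but the prefactor vanishes.
  have e1 : (C (2 * m * a) * X ^ (m - 1) : ℝ[X]).coeff k = 0 := by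
    rw [coeff_C_mul, coeff_X_pow]
    rcases m with _ | m
    · simp
    · rw [if_neg (by omega), mul_zero]
  have e2 : (C (2 * (m * (m - 1) : ℝ)) * X ^ (m - 2) : ℝ[X]).coeff k = 0 := by
    rw [coeff_C_mul, coeff_X_pow]
    rcases m with _ | _ | m
    · simp
    · simp
    · rw [if_neg (by omega), mul_zero]
  rw [invCovPow]
  simp only [coeff_add, coeff_sub, e1, e2, coeff_C_mul, coeff_X_pow, finsetSum_coeff]
  rw [Finset.sum_congr rfl fun l _ => by
    rw [coeff_powRemainder_of_le (z l) m k (by omega)]]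
  rcases h.eq_or_lt with rfl | h
  · simp only [coeff_powRemainder, if_true, eigenvalue]
    simp
    ring
  · rw [Finset.sum_congr rfl fun l _ => by
      rw [coeff_powRemainder_of_le (z l) (m + 2) k (by omega)]]
    simp [h.ne']

theorem exists_invCov_mulVec_eigenvec_pow {a b : ℝ} {z : Fin N → ℝ} (hz : Function.Injective z)
    (hmem : ∀ i, z i ∈ Set.Ioo (-1 : ℝ) 1)
    (hcrit : ∀ i, ∑ l ∈ Finset.univ.erase i, 2 / (z i - z l) =
      (a + b) / (1 - z i) - b / (1 + z i)) (m : ℕ) :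
    ∃ r : ℝ[X], r.degree < m ∧ invCov a b z *ᵥ eigenvec z (X ^ m) =
      eigenvalue N (a + b - 1) (b - 1) (m + 1) • eigenvec z (X ^ m) + eigenvec z r := by
  refine ⟨invCovPow a b z m - C (eigenvalue N (a + b - 1) (b - 1) (m + 1)) * X ^ m, ?_, ?_⟩
  · rw [degree_lt_iff_coeff_zero]
    intro k hk
    rw [coeff_sub, coeff_invCovPow a b z m k hk, coeff_C_mul, coeff_X_pow]
    split_ifs <;> simp
  · rw [invCov_mulVec_eigenvec_pow hz hmem hcrit, ← eigenvec_C_mul, ← eigenvec_add,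
      add_sub_cancel]

/-- A triangular operator with distinct diagonal entries can be solved below the diagonal. -/
theorem exists_triangular_solution {E : Type*} [AddCommGroup E] [Module ℝ E]
    (e : ℝ[X] →ₗ[ℝ] E) (L : E →ₗ[ℝ] E) (lam : ℕ → ℝ)
    (hL : ∀ m : ℕ, ∃ r : ℝ[X], r.degree < m ∧ L (e (X ^ m)) = lam m • e (X ^ m) + e r)
    (mu : ℝ) (d : ℕ) (hmu : ∀ j < d, lam j ≠ mu) (r : ℝ[X]) (hr : r.degree < d) :
    ∃ p : ℝ[X], p.degree < d ∧ L (e p) - mu • e p = e r := by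
  induction d generalizing r with
  | zero =>
    have : r = 0 := by simpa [Nat.WithBot.lt_zero_iff] using hr
    exact ⟨0, by simp, by simp [this]⟩
  | succ d ih =>
    obtain ⟨s, hs, hLs⟩ := hL d
    have hne : lam d - mu ≠ 0 := sub_ne_zero.2 (hmu d (Nat.lt_succ_self d))
    -- This multiple of X^d matches the top coefficient of r; its by-product `c • s` has lower
    -- degree and is left to the induction.
    set c := r.coeff d / (lam d - mu) with hc
    have hr' : (r - r.coeff d • X ^ d - c • s).degree < (d : WithBot ℕ) := by
      rw [degree_lt_iff_coeff_zero] at hr hs ⊢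
      intro k hk
      rw [coeff_sub, coeff_sub, coeff_smul, coeff_smul, hs k hk, coeff_X_pow]
      rcases hk.eq_or_lt with rfl | hk'
      · simp
      · rw [hr k hk', if_neg hk'.ne']; simp
    obtain ⟨p, hp, hLp⟩ := ih (fun j hj => hmu j (hj.trans (Nat.lt_succ_self d))) _ hr'
    refine ⟨c • X ^ d + p, ?_, ?_⟩
    · rw [degree_lt_iff_coeff_zero] at hp ⊢
      intro k hk
      rw [coeff_add, coeff_smul, coeff_X_pow, hp k (by omega), if_neg (by omega)]; simp
    · simp only [map_add, map_smul, map_sub] at hLp ⊢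
      rw [hLs]
      have h2 : L (e p) = (e r - r.coeff d • e (X ^ d) - c • e s) + mu • e p := by
        rw [← hLp]; abel
      have h3 : r.coeff d = c * (lam d - mu) := by rw [hc]; field_simp
      rw [h2, h3]
      module

/-- Correct X^m by a lower-degree p with (L - λ_m) e(p) = -e(r); only the diagonal entries below m
have to differ from λ_m. -/
theorem exists_monic_eigenpolynomial {E : Type*} [AddCommGroup E] [Module ℝ E]
    (e : ℝ[X] →ₗ[ℝ] E) (L : E →ₗ[ℝ] E) (lam : ℕ → ℝ)
    (hL : ∀ m : ℕ, ∃ r : ℝ[X], r.degree < m ∧ L (e (X ^ m)) = lam m • e (X ^ m) + e r)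
    (m : ℕ) (hlam : ∀ j < m, lam j ≠ lam m) :
    ∃ q : ℝ[X], q.degree = m ∧ L (e q) = lam m • e q := by
  obtain ⟨r, hr, hLr⟩ := hL m
  obtain ⟨p, hp, hLp⟩ := exists_triangular_solution e L lam hL (lam m) m hlam (-r)
    (by rwa [degree_neg])
  refine ⟨X ^ m + p, ?_, ?_⟩
  · rw [degree_add_eq_left_of_degree_lt (by rwa [degree_X_pow]), degree_X_pow]
  · rw [map_add, map_add, hLr, eq_add_of_sub_eq hLp, map_neg]
    module

end Operator

/-! ### Eigenvalues, eigenvectors and orthonormality. -/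

section Eigenvectors

variable {N : ℕ}

/-- The difference is 2(k - j)(2N + a + 2b - 1 - k - j), and j + k ≤ 2N - 1. -/
theorem eigenvalue_lt_eigenvalue {a b : ℝ} (ha : 0 ≤ a) (hb : 0 < b) {j k : ℕ} (hjk : j < k)
    (hk : k ≤ N) :
    eigenvalue N (a + b - 1) (b - 1) j < eigenvalue N (a + b - 1) (b - 1) k := by
  have h1 : (j : ℝ) + 1 ≤ k := by exact_mod_cast hjk
  have h2 : (k : ℝ) ≤ N := by exact_mod_cast hk
  simp only [eigenvalue]
  nlinarith [mul_pos (by linarith : (0 : ℝ) < k - j)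
    (by linarith : (0 : ℝ) < 2 * N + a + 2 * b - 1 - k - j)]

theorem discreteMeasure_integral {z : Fin N → ℝ} (hmem : ∀ i, z i ∈ Set.Ioo (-1 : ℝ) 1)
    (f : ℝ → ℝ) : ∫ x, f x ∂(discreteMeasure z) = ∑ i, (1 - z i ^ 2) * f (z i) := by
  have hpos : ∀ l, 0 ≤ 1 - z l ^ 2 := fun l => by nlinarith [(hmem l).1, (hmem l).2]
  rw [discreteMeasure, integral_finsetSum_measure]
  · refine Finset.sum_congr rfl fun i _ => ?_
    rw [integral_smul_measure, integral_dirac, ENNReal.toReal_ofReal (hpos i), smul_eq_mul]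
  · intro i _
    exact (integrable_dirac (by simp)).smul_measure ENNReal.ofReal_ne_top

theorem discreteMeasure_integral_mul {z : Fin N → ℝ} (hmem : ∀ i, z i ∈ Set.Ioo (-1 : ℝ) 1)
    (p q : ℝ[X]) : ∫ x, p.eval x * q.eval x ∂(discreteMeasure z) =
      eigenvec z p ⬝ᵥ eigenvec z q := by
  rw [discreteMeasure_integral hmem, dotProduct]
  refine Finset.sum_congr rfl fun i _ => ?_
  have := Real.mul_self_sqrt (show 0 ≤ 1 - z i ^ 2 by nlinarith [(hmem i).1, (hmem i).2])
  simp only [eigenvec]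
  linear_combination -(p.eval (z i) * q.eval (z i)) * this

theorem eigenvec_ne_zero {z : Fin N → ℝ} (hz : Function.Injective z)
    (hmem : ∀ i, z i ∈ Set.Ioo (-1 : ℝ) 1) {q : ℝ[X]} {m : ℕ} (hq : q.degree = m) (hm : m < N) :
    eigenvec z q ≠ 0 := by
  intro h
  have hq0 : q = 0 := by
    refine eq_zero_of_natDegree_lt_card_of_eval_eq_zero q hz (fun i => ?_) ?_
    · have h1 := congrFun h i
      have h2 : √(1 - z i ^ 2) ≠ 0 :=
        (Real.sqrt_pos.2 (by nlinarith [(hmem i).1, (hmem i).2])).ne'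
      simpa [eigenvec, h2] using h1
    · rw [natDegree_eq_of_degree_eq_some hq, Fintype.card_fin]; exact hm
  simp [hq0] at hq

theorem charpoly_eq_prod_of_hasEigenvalue {n : ℕ} (S : Matrix (Fin n) (Fin n) ℝ) {lam : Fin n → ℝ}
    (hlam : Function.Injective lam)
    (h : ∀ k, Module.End.HasEigenvalue (Matrix.toLin' S) (lam k)) :
    S.charpoly = ∏ k, (X - C (lam k)) := by
  refine eq_of_monic_of_dvd_of_natDegree_le (monic_prod_of_monic _ _ fun k _ => monic_X_sub_C (lam k))
    (Matrix.charpoly_monic S) ?_ ?_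
  · refine Finset.prod_dvd_of_coprime (fun i _ j _ hij => ?_) fun k _ => ?_
    · exact pairwise_coprime_X_sub_C hlam hij
    · rw [dvd_iff_isRoot]
      have := (Module.End.hasEigenvalue_iff_isRoot_charpoly _ _).1 (h k)
      rwa [Matrix.charpoly_toLin'] at this
  · rw [Matrix.charpoly_natDegree_eq_dim, natDegree_prod_of_monic _ _ fun k _ => monic_X_sub_C (lam k)]
    simp

/-- Integration against the discrete measure is the dot product of the sampled vectors, so
eigenvectors of the symmetric matrix for distinct eigenvalues give orthogonal polynomials; only
normalization remains. -/
theorem exists_orthonormal_eigenpolynomials {a b : ℝ} (ha : 0 ≤ a) (hb : 0 < b) {z : Fin N → ℝ}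
    (hz : Function.Injective z) (hmem : ∀ i, z i ∈ Set.Ioo (-1 : ℝ) 1)
    (hcrit : ∀ i, ∑ l ∈ Finset.univ.erase i, 2 / (z i - z l) =
      (a + b) / (1 - z i) - b / (1 + z i)) :
    ∃ q : Fin N → ℝ[X],
      (∀ k : Fin N, (q k).degree = ((k : ℕ) : WithBot ℕ)) ∧
      (∀ k l : Fin N, ∫ x, (q k).eval x * (q l).eval x ∂(discreteMeasure z) =
        if k = l then 1 else 0) ∧
      ∀ k : Fin N, Module.End.HasEigenvector (Matrix.toLin' (invCov a b z))
        (eigenvalue N (a + b - 1) (b - 1) (k + 1)) (eigenvec z (q k)) := by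
  set lam : ℕ → ℝ := fun m => eigenvalue N (a + b - 1) (b - 1) (m + 1) with hlam
  set e : ℝ[X] →ₗ[ℝ] (Fin N → ℝ) :=
    { toFun := eigenvec z
      map_add' := eigenvec_add z
      map_smul' := fun c q => by rw [smul_eq_C_mul, eigenvec_C_mul]; rfl } with he
  have hinj : ∀ j k : Fin N, j ≠ k → lam j ≠ lam k := by
    intro j k hjk
    rcases lt_or_gt_of_ne hjk with h | h
    · exact (eigenvalue_lt_eigenvalue ha hb (Nat.succ_lt_succ h) k.2).ne
    · exact (eigenvalue_lt_eigenvalue ha hb (Nat.succ_lt_succ h) j.2).ne'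
  have hex : ∀ k : Fin N, ∃ p : ℝ[X], p.degree = ((k : ℕ) : WithBot ℕ) ∧
      invCov a b z *ᵥ eigenvec z p = lam k • eigenvec z p := by
    intro k
    obtain ⟨p, hp, hLp⟩ := exists_monic_eigenpolynomial e (Matrix.toLin' (invCov a b z)) lam
      (fun m => exists_invCov_mulVec_eigenvec_pow hz hmem hcrit m) k
      (fun j hj => hinj ⟨j, hj.trans k.2⟩ k (Fin.ne_of_lt hj))
    exact ⟨p, hp, hLp⟩
  choose p hp hLp using hex
  have hne : ∀ k, eigenvec z (p k) ≠ 0 := fun k => eigenvec_ne_zero hz hmem (hp k) k.2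
  have hnorm : ∀ k, 0 < eigenvec z (p k) ⬝ᵥ eigenvec z (p k) := fun k =>
    lt_of_le_of_ne (Finset.sum_nonneg fun i _ => mul_self_nonneg _)
      (fun h => hne k (dotProduct_self_eq_zero.1 h.symm))
  have horth : ∀ k l, k ≠ l → eigenvec z (p k) ⬝ᵥ eigenvec z (p l) = 0 := by
    intro k l hkl
    have h1 : (invCov a b z *ᵥ eigenvec z (p k)) ⬝ᵥ eigenvec z (p l) =
        eigenvec z (p k) ⬝ᵥ (invCov a b z *ᵥ eigenvec z (p l)) := by
      rw [Matrix.dotProduct_mulVec, ← Matrix.mulVec_transpose, (invCov_isSymm a b z).eq]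
    rw [hLp, hLp, smul_dotProduct, dotProduct_smul, smul_eq_mul, smul_eq_mul] at h1
    have h2 : (lam k - lam l) * (eigenvec z (p k) ⬝ᵥ eigenvec z (p l)) = 0 := by
      linear_combination h1
    exact (mul_eq_zero.1 h2).resolve_left (sub_ne_zero.2 (hinj k l hkl))
  set c : Fin N → ℝ := fun k => (√(eigenvec z (p k) ⬝ᵥ eigenvec z (p k)))⁻¹ with hc
  have hcpos : ∀ k, c k ≠ 0 := fun k => inv_ne_zero (Real.sqrt_pos.2 (hnorm k)).ne'
  refine ⟨fun k => C (c k) * p k, fun k => ?_, fun k l => ?_, fun k => ?_⟩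
  · rw [degree_C_mul (hcpos k), hp]
  · rw [discreteMeasure_integral_mul hmem, eigenvec_C_mul, eigenvec_C_mul, smul_dotProduct,
      dotProduct_smul, smul_eq_mul, smul_eq_mul]
    split_ifs with h
    · subst h
      have h1 := Real.mul_self_sqrt (hnorm k).le
      have h2 := (Real.sqrt_pos.2 (hnorm k)).ne'
      simp only [hc]
      field_simp
      rw [sq]; exact h1.symm
    · rw [horth k l h]; simp
  · rw [Module.End.hasEigenvector_iff, Module.End.mem_eigenspace_iff, Matrix.toLin'_apply,
      eigenvec_C_mul, Matrix.mulVec_smul, hLp, smul_comm]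
    exact ⟨rfl, smul_ne_zero (hcpos k) (hne k)⟩

end Eigenvectors

end BetaJacobi

namespace BetaJacobi

/-! ### Concavity and second-order expansion of log sin. -/

section LogSin

theorem hasDerivAt_log_sin {x : ℝ} (hx : Real.sin x ≠ 0) :
    HasDerivAt (fun y => Real.log (Real.sin y)) (Real.cos x / Real.sin x) x :=
  (Real.hasDerivAt_sin x).log hx

theorem hasDerivAt_cos_div_sin {x : ℝ} (hx : Real.sin x ≠ 0) :
    HasDerivAt (fun y => Real.cos y / Real.sin y) (-(1 / Real.sin x ^ 2)) x := by
  convert! (Real.hasDerivAt_cos x).div (Real.hasDerivAt_sin x) hx using 1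
  have := Real.sin_sq_add_cos_sq x
  field_simp
  linear_combination this

theorem antitoneOn_cos_div_sin_add :
    AntitoneOn (fun y => Real.cos y / Real.sin y + y) (Set.Ioo 0 Real.pi) := by
  have hd : ∀ y ∈ Set.Ioo 0 Real.pi,
      HasDerivAt (fun y => Real.cos y / Real.sin y + y) (-(1 / Real.sin y ^ 2) + 1) y := fun y hy =>
    (hasDerivAt_cos_div_sin (Real.sin_pos_of_mem_Ioo hy).ne').add (hasDerivAt_id y)
  refine antitoneOn_of_deriv_nonpos (convex_Ioo _ _)
    (fun y hy => (hd y hy).continuousAt.continuousWithinAt) ?_ ?_ <;> rw [interior_Ioo]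
  · exact fun y hy => (hd y hy).differentiableAt.differentiableWithinAt
  · intro y hy
    rw [(hd y hy).deriv]
    have h1 := Real.sin_pos_of_mem_Ioo hy
    have : 1 ≤ 1 / Real.sin y ^ 2 := by
      rw [le_div_iff₀ (by positivity), one_mul]
      exact Real.sin_sq_le_one y
    linarith

/-- `log ∘ sin` is strongly concave on `(0, π)`. -/
theorem log_sin_le {x y : ℝ} (hx : x ∈ Set.Ioo 0 Real.pi) (hy : y ∈ Set.Ioo 0 Real.pi) :
    Real.log (Real.sin y) ≤ Real.log (Real.sin x) + Real.cos x / Real.sin x * (y - x) -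
      (y - x) ^ 2 / 2 := by
  set g : ℝ → ℝ := fun w => Real.log (Real.sin w) + w ^ 2 / 2 with hg
  have hd : ∀ w ∈ Set.Ioo 0 Real.pi, HasDerivAt g (Real.cos w / Real.sin w + w) w := by
    intro w hw
    have h2 : HasDerivAt (fun w : ℝ => w ^ 2 / 2) w w := by
      simpa using (hasDerivAt_pow 2 w).div_const 2
    exact (hasDerivAt_log_sin (Real.sin_pos_of_mem_Ioo hw).ne').add h2
  have hconc : ConcaveOn ℝ (Set.Ioo 0 Real.pi) g := by
    refine AntitoneOn.concaveOn_of_deriv (convex_Ioo _ _)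
      (fun w hw => (hd w hw).continuousAt.continuousWithinAt) ?_ ?_ <;> rw [interior_Ioo]
    · exact fun w hw => (hd w hw).differentiableAt.differentiableWithinAt
    · exact antitoneOn_cos_div_sin_add.congr fun w hw => ((hd w hw).deriv).symm
  have key : g y ≤ g x + (Real.cos x / Real.sin x + x) * (y - x) := by
    rcases lt_trichotomy x y with h | h | h
    · have := hconc.slope_le_of_hasDerivAt hx hy h (hd x hx)
      rw [slope_def_field, div_le_iff₀ (by linarith)] at this
      linarith
    · subst h; simp
    · have := hconc.le_slope_of_hasDerivAt hy hx h (hd x hx)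
      rw [slope_def_field, le_div_iff₀ (by linarith)] at this
      linarith
  simp only [hg] at key
  nlinarith [key]

/-- The remainder has derivative f'(w) - f'(x) - c(w - x) = o(w - x); the mean value inequality on
the ball of radius |y - x| supplies the second factor |y - x|. -/
theorem taylor_two_isLittleO {f f' : ℝ → ℝ} {x c : ℝ}
    (hf : ∀ᶠ y in 𝓝 x, HasDerivAt f (f' y) y) (hf' : HasDerivAt f' c x) :
    (fun y => f y - f x - f' x * (y - x) - c / 2 * (y - x) ^ 2) =o[𝓝 x]
      fun y => (y - x) ^ 2 := by
  rw [Asymptotics.isLittleO_iff]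
  intro ε hε
  have h1 := (hasDerivAt_iff_isLittleO.1 hf')
  rw [Asymptotics.isLittleO_iff] at h1
  obtain ⟨δ, hδ, hball⟩ := Metric.eventually_nhds_iff_ball.1 (hf.and (h1 hε))
  refine Metric.eventually_nhds_iff_ball.2 ⟨δ, hδ, fun y hy => ?_⟩
  set r : ℝ → ℝ := fun y => f y - f x - f' x * (y - x) - c / 2 * (y - x) ^ 2 with hr
  have hrd : ∀ w ∈ Metric.ball x δ, HasDerivAt r (f' w - f' x - c * (w - x)) w := by
    intro w hw
    have h2 : HasDerivAt (fun w => w - x) 1 w := (hasDerivAt_id w).sub_const x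
    have h3 := (((hball w hw).1.sub_const (f x)).sub (h2.const_mul (f' x))).sub
      ((h2.pow 2).const_mul (c / 2))
    convert! h3 using 1
    simp only [Nat.cast_ofNat, Nat.add_one_sub_one, pow_one, mul_one]
    ring
  set s := Metric.closedBall x |y - x| with hs
  have hsub : s ⊆ Metric.ball x δ := Metric.closedBall_subset_ball (by
    simpa [Real.dist_eq] using hy)
  have hbound := (convex_closedBall x |y - x|).norm_image_sub_le_of_norm_hasDerivWithin_le
    (f := r) (f' := fun w => f' w - f' x - c * (w - x)) (C := ε * |y - x|)
    (fun w hw => (hrd w (hsub hw)).hasDerivWithinAt) (fun w hw => ?_)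
    (Metric.mem_closedBall_self (abs_nonneg _))
    (show y ∈ s by simp [hs, Real.dist_eq])
  · have hx0 : r x = 0 := by simp [hr]
    rw [hx0, sub_zero] at hbound
    refine hbound.trans (le_of_eq ?_)
    rw [Real.norm_eq_abs, Real.norm_eq_abs, abs_pow]
    ring
  · have h4 := (hball w (hsub hw)).2
    rw [Metric.mem_closedBall, Real.dist_eq] at hw
    rw [smul_eq_mul, mul_comm (w - x) c] at h4
    exact h4.trans (mul_le_mul_of_nonneg_left hw hε.le)

theorem log_sin_expansion {x : ℝ} (hx : Real.sin x ≠ 0) (v : ℝ) :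
    Tendsto (fun s : ℝ => (Real.log (Real.sin (x + s * v)) - Real.log (Real.sin x) -
      s * (v * (Real.cos x / Real.sin x))) / s ^ 2) (𝓝[≠] 0)
      (𝓝 (-(v ^ 2 / Real.sin x ^ 2) / 2)) := by
  have hev : ∀ᶠ y in 𝓝 x, HasDerivAt (fun y => Real.log (Real.sin y))
      (Real.cos y / Real.sin y) y :=
    (Real.continuous_sin.continuousAt.eventually_ne hx).mono fun y hy => hasDerivAt_log_sin hy
  have h1 := taylor_two_isLittleO hev (hasDerivAt_cos_div_sin hx)
  have hlim : Tendsto (fun s : ℝ => x + s * v) (𝓝[≠] 0) (𝓝 x) := by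
    have : Tendsto (fun s : ℝ => x + s * v) (𝓝 0) (𝓝 (x + 0 * v)) :=
      Continuous.tendsto (by fun_prop) 0
    rw [zero_mul, add_zero] at this
    exact this.mono_left nhdsWithin_le_nhds
  have h2 := h1.comp_tendsto hlim
  have h3 : (fun s : ℝ => (x + s * v - x) ^ 2) =O[𝓝[≠] 0] fun s => s ^ 2 := by
    refine Asymptotics.IsBigO.of_bound (v ^ 2) (Eventually.of_forall fun s => ?_)
    rw [Real.norm_eq_abs, Real.norm_eq_abs, abs_of_nonneg (by positivity),
      abs_of_nonneg (by positivity)]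
    exact le_of_eq (by ring)
  have h4 := (h2.trans_isBigO h3).tendsto_div_nhds_zero
  have h5 := h4.add_const (-(v ^ 2 / Real.sin x ^ 2) / 2)
  rw [zero_add] at h5
  refine h5.congr' ?_
  filter_upwards [self_mem_nhdsWithin] with s hs
  have hs' : s ≠ 0 := hs
  simp only [Function.comp_apply]
  field_simp
  ring

end LogSin

/-! ### The logarithmic potential on the open alcove. -/

section Potential

variable {N : ℕ}

/-- The logarithm of `trigWeight a b 1`, up to an additive constant. -/
noncomputable def logWeight (a b : ℝ) (t : EuclideanSpace ℝ (Fin N)) : ℝ :=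
  (∑ i : Fin N, ∑ j ∈ Finset.Ioi i,
    (Real.log (Real.sin (t i + t j)) + Real.log (Real.sin (t i - t j)))) +
  ∑ i : Fin N, (a * Real.log (Real.sin (t i)) + b * Real.log (Real.sin (2 * t i)))

/-- The derivative of `logWeight` at `t` in direction `u`. -/
noncomputable def logWeightDeriv (a b : ℝ) (t u : EuclideanSpace ℝ (Fin N)) : ℝ :=
  (∑ i : Fin N, ∑ j ∈ Finset.Ioi i,
    ((u i + u j) * (Real.cos (t i + t j) / Real.sin (t i + t j)) +
      (u i - u j) * (Real.cos (t i - t j) / Real.sin (t i - t j)))) +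
  ∑ i : Fin N, (a * (u i * (Real.cos (t i) / Real.sin (t i))) +
    b * (2 * u i * (Real.cos (2 * t i) / Real.sin (2 * t i))))

/-- Minus the second derivative of `logWeight` at `t` in direction `u`. -/
noncomputable def logWeightQuad (a b : ℝ) (t u : EuclideanSpace ℝ (Fin N)) : ℝ :=
  (∑ i : Fin N, ∑ j ∈ Finset.Ioi i,
    ((u i + u j) ^ 2 / Real.sin (t i + t j) ^ 2 + (u i - u j) ^ 2 / Real.sin (t i - t j) ^ 2)) +
  ∑ i : Fin N, (a * (u i ^ 2 / Real.sin (t i) ^ 2) +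
    b * ((2 * u i) ^ 2 / Real.sin (2 * t i) ^ 2))

/-- The interior of the alcove. -/
def openAlcove (N : ℕ) : Set (EuclideanSpace ℝ (Fin N)) :=
  {t | (∀ i, 0 < t i ∧ t i < Real.pi / 2) ∧ ∀ i j, i < j → t j < t i}

theorem isOpen_openAlcove : IsOpen (openAlcove N) := by
  simp only [openAlcove, Set.ofPred_and, Set.ofPred_forall]
  refine IsOpen.inter (isOpen_iInter_of_finite fun i => IsOpen.inter ?_ ?_)
    (isOpen_iInter_of_finite fun i => isOpen_iInter_of_finite fun j =>
      isOpen_iInter_of_finite fun _ => ?_)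
  all_goals exact isOpen_lt (by fun_prop) (by fun_prop)

theorem openAlcove_subset : openAlcove N ⊆ trigAlcove N := fun t ht =>
  ⟨fun i => ⟨(ht.1 i).1.le, (ht.1 i).2.le⟩, fun i j hij => by
    rcases hij.eq_or_lt with h | h
    · rw [h]
    · exact (ht.2 i j h).le⟩

theorem openAlcove_nonempty : (openAlcove N).Nonempty := by
  -- Equally spaced decreasing points; since i runs from 0 to N - 1, the fraction stays strictly
  -- between 0 and 1.
  refine ⟨WithLp.toLp 2 fun i => Real.pi / 2 * ((N - i) / (N + 1)), fun i => ?_, fun i j hij => ?_⟩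
  · have h1 : (i : ℝ) < N := by exact_mod_cast i.2
    have h2 : (0 : ℝ) ≤ i := by positivity
    have h3 : ((N : ℝ) - i) / (N + 1) < 1 := by rw [div_lt_one (by positivity)]; linarith
    have h4 : 0 < ((N : ℝ) - i) / (N + 1) := div_pos (by linarith) (by positivity)
    have := Real.pi_pos
    constructor
    · simp only; positivity
    · simp only; nlinarith
  · have h1 : (i : ℝ) < j := by exact_mod_cast hij
    have := Real.pi_pos
    simp only
    gcongr

theorem mem_Ioo_of_mem_openAlcove {t : EuclideanSpace ℝ (Fin N)} (ht : t ∈ openAlcove N)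
    (i : Fin N) : t i ∈ Set.Ioo 0 Real.pi ∧ 2 * t i ∈ Set.Ioo 0 Real.pi := by
  obtain ⟨h1, h2⟩ := ht.1 i
  exact ⟨⟨h1, by linarith⟩, ⟨by linarith, by linarith⟩⟩

theorem mem_Ioo_of_mem_openAlcove_of_lt {t : EuclideanSpace ℝ (Fin N)} (ht : t ∈ openAlcove N)
    {i j : Fin N} (hij : i < j) :
    t i + t j ∈ Set.Ioo 0 Real.pi ∧ t i - t j ∈ Set.Ioo 0 Real.pi := by
  obtain ⟨h1, h2⟩ := ht.1 i
  obtain ⟨h3, h4⟩ := ht.1 j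
  have h5 := ht.2 i j hij
  exact ⟨⟨by linarith, by linarith⟩, ⟨by linarith, by linarith⟩⟩

theorem trigWeight_eq_exp {a b : ℝ} {t : EuclideanSpace ℝ (Fin N)} (ht : t ∈ openAlcove N) :
    trigWeight a b 1 t = (∏ i : Fin N, ∏ _j ∈ Finset.Ioi i, 2) * Real.exp (logWeight a b t) := by
  have h1 : ∏ i : Fin N, ∏ j ∈ Finset.Ioi i, (Real.cos (2 * t j) - Real.cos (2 * t i)) ^ (1 : ℝ) =
      (∏ i : Fin N, ∏ _j ∈ Finset.Ioi i, 2) * Real.exp (∑ i : Fin N, ∑ j ∈ Finset.Ioi i,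
        (Real.log (Real.sin (t i + t j)) + Real.log (Real.sin (t i - t j)))) := by
    rw [Real.exp_sum, ← Finset.prod_mul_distrib]
    refine Finset.prod_congr rfl fun i _ => ?_
    rw [Real.exp_sum, ← Finset.prod_mul_distrib]
    refine Finset.prod_congr rfl fun j hj => ?_
    obtain ⟨h1, h2⟩ := mem_Ioo_of_mem_openAlcove_of_lt ht (Finset.mem_Ioi.1 hj)
    rw [Real.exp_add, Real.exp_log (Real.sin_pos_of_mem_Ioo h1),
      Real.exp_log (Real.sin_pos_of_mem_Ioo h2), Real.rpow_one, Real.cos_sub_cos,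
      show (2 * t j + 2 * t i) / 2 = t i + t j by ring,
      show (2 * t j - 2 * t i) / 2 = -(t i - t j) by ring, Real.sin_neg]
    ring
  have h2 : ∏ i : Fin N, (Real.sin (t i) ^ a * Real.sin (2 * t i) ^ b) =
      Real.exp (∑ i : Fin N,
        (a * Real.log (Real.sin (t i)) + b * Real.log (Real.sin (2 * t i)))) := by
    rw [Real.exp_sum]
    refine Finset.prod_congr rfl fun i _ => ?_
    obtain ⟨h1, h2⟩ := mem_Ioo_of_mem_openAlcove ht i
    rw [Real.exp_add, Real.rpow_def_of_pos (Real.sin_pos_of_mem_Ioo h1),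
      Real.rpow_def_of_pos (Real.sin_pos_of_mem_Ioo h2), mul_comm a, mul_comm b]
  rw [trigWeight, h1, h2, logWeight, Real.exp_add, mul_assoc]

/-- The terms log sin(2t_i) alone provide the quadratic gain: the displacement doubles, and b(2δ)²/2
= 2bδ². This works for a = 0 as well. -/
theorem logWeight_le {a b : ℝ} (ha : 0 ≤ a) (hb : 0 < b) {t₀ t : EuclideanSpace ℝ (Fin N)}
    (ht₀ : t₀ ∈ openAlcove N) (ht : t ∈ openAlcove N) :
    logWeight a b t ≤ logWeight a b t₀ + logWeightDeriv a b t₀ (t - t₀) -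
      2 * b * ‖t - t₀‖ ^ 2 := by
  have key : logWeight a b t + ∑ i, 2 * b * (t i - t₀ i) ^ 2 ≤
      logWeight a b t₀ + logWeightDeriv a b t₀ (t - t₀) := by
    have hA : ∑ i : Fin N, ∑ j ∈ Finset.Ioi i,
        (Real.log (Real.sin (t i + t j)) + Real.log (Real.sin (t i - t j))) ≤
        ∑ i : Fin N, ∑ j ∈ Finset.Ioi i,
          (Real.log (Real.sin (t₀ i + t₀ j)) + Real.log (Real.sin (t₀ i - t₀ j))) +
        ∑ i : Fin N, ∑ j ∈ Finset.Ioi i,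
          (((t - t₀) i + (t - t₀) j) * (Real.cos (t₀ i + t₀ j) / Real.sin (t₀ i + t₀ j)) +
          ((t - t₀) i - (t - t₀) j) * (Real.cos (t₀ i - t₀ j) / Real.sin (t₀ i - t₀ j))) := by
      rw [← Finset.sum_add_distrib]
      refine Finset.sum_le_sum fun i _ => ?_
      rw [← Finset.sum_add_distrib]
      refine Finset.sum_le_sum fun j hj => ?_
      obtain ⟨h1, h2⟩ := mem_Ioo_of_mem_openAlcove_of_lt ht (Finset.mem_Ioi.1 hj)
      obtain ⟨h3, h4⟩ := mem_Ioo_of_mem_openAlcove_of_lt ht₀ (Finset.mem_Ioi.1 hj)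
      have e1 := log_sin_le h3 h1
      have e2 := log_sin_le h4 h2
      simp only [PiLp.sub_apply]
      linarith [sq_nonneg (t i + t j - (t₀ i + t₀ j)), sq_nonneg (t i - t j - (t₀ i - t₀ j))]
    have hB : ∑ i : Fin N, (a * Real.log (Real.sin (t i)) + b * Real.log (Real.sin (2 * t i))) +
        ∑ i, 2 * b * (t i - t₀ i) ^ 2 ≤
        ∑ i : Fin N, (a * Real.log (Real.sin (t₀ i)) + b * Real.log (Real.sin (2 * t₀ i))) +
        ∑ i : Fin N, (a * ((t - t₀) i * (Real.cos (t₀ i) / Real.sin (t₀ i))) +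
          b * (2 * (t - t₀) i * (Real.cos (2 * t₀ i) / Real.sin (2 * t₀ i)))) := by
      rw [← Finset.sum_add_distrib, ← Finset.sum_add_distrib]
      refine Finset.sum_le_sum fun i _ => ?_
      obtain ⟨h1, h2⟩ := mem_Ioo_of_mem_openAlcove ht i
      obtain ⟨h3, h4⟩ := mem_Ioo_of_mem_openAlcove ht₀ i
      have e1 := mul_le_mul_of_nonneg_left (log_sin_le h3 h1) ha
      have e2 := mul_le_mul_of_nonneg_left (log_sin_le h4 h2) hb.le
      have e3 : 0 ≤ a * ((t i - t₀ i) ^ 2 / 2) := by positivity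
      simp only [PiLp.sub_apply]
      linarith
    simp only [logWeight, logWeightDeriv]
    linarith
  rw [EuclideanSpace.real_norm_sq_eq, Finset.mul_sum]
  simp only [PiLp.sub_apply]
  linarith

theorem logWeight_expansion (a b : ℝ) {t : EuclideanSpace ℝ (Fin N)}
    (ht : t ∈ openAlcove N) (u : EuclideanSpace ℝ (Fin N)) :
    Tendsto (fun s : ℝ => (logWeight a b (t + s • u) - logWeight a b t -
      s * logWeightDeriv a b t u) / s ^ 2) (𝓝[≠] 0) (𝓝 (-logWeightQuad a b t u / 2)) := by
  have h1 : Tendsto (fun s : ℝ => (∑ i : Fin N, ∑ j ∈ Finset.Ioi i,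
      ((Real.log (Real.sin (t i + t j + s * (u i + u j))) - Real.log (Real.sin (t i + t j)) -
        s * ((u i + u j) * (Real.cos (t i + t j) / Real.sin (t i + t j)))) / s ^ 2 +
      (Real.log (Real.sin (t i - t j + s * (u i - u j))) - Real.log (Real.sin (t i - t j)) -
        s * ((u i - u j) * (Real.cos (t i - t j) / Real.sin (t i - t j)))) / s ^ 2)) +
      ∑ i : Fin N,
      (a * ((Real.log (Real.sin (t i + s * u i)) - Real.log (Real.sin (t i)) -
        s * (u i * (Real.cos (t i) / Real.sin (t i)))) / s ^ 2) +
      b * ((Real.log (Real.sin (2 * t i + s * (2 * u i))) - Real.log (Real.sin (2 * t i)) -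
        s * (2 * u i * (Real.cos (2 * t i) / Real.sin (2 * t i)))) / s ^ 2))) (𝓝[≠] 0)
      (𝓝 ((∑ i : Fin N, ∑ j ∈ Finset.Ioi i,
        (-((u i + u j) ^ 2 / Real.sin (t i + t j) ^ 2) / 2 +
          -((u i - u j) ^ 2 / Real.sin (t i - t j) ^ 2) / 2)) +
        ∑ i : Fin N, (a * (-(u i ^ 2 / Real.sin (t i) ^ 2) / 2) +
          b * (-((2 * u i) ^ 2 / Real.sin (2 * t i) ^ 2) / 2)))) := by
    refine (tendsto_finsetSum _ fun i _ => tendsto_finsetSum _ fun j hj => ?_).add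
      (tendsto_finsetSum _ fun i _ => ?_)
    · obtain ⟨h1, h2⟩ := mem_Ioo_of_mem_openAlcove_of_lt ht (Finset.mem_Ioi.1 hj)
      exact (log_sin_expansion (Real.sin_pos_of_mem_Ioo h1).ne' _).add
        (log_sin_expansion (Real.sin_pos_of_mem_Ioo h2).ne' _)
    · obtain ⟨h1, h2⟩ := mem_Ioo_of_mem_openAlcove ht i
      exact ((log_sin_expansion (Real.sin_pos_of_mem_Ioo h1).ne' _).const_mul a).add
        ((log_sin_expansion (Real.sin_pos_of_mem_Ioo h2).ne' _).const_mul b)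
  convert! h1 using 1
  · ext s
    simp only [logWeight, logWeightDeriv]
    rw [mul_add, add_sub_add_comm, add_sub_add_comm, add_div, Finset.mul_sum, Finset.mul_sum,
      ← Finset.sum_sub_distrib, ← Finset.sum_sub_distrib, ← Finset.sum_sub_distrib,
      ← Finset.sum_sub_distrib, Finset.sum_div, Finset.sum_div]
    congr 1
    · refine Finset.sum_congr rfl fun i _ => ?_
      rw [Finset.mul_sum, ← Finset.sum_sub_distrib, ← Finset.sum_sub_distrib, Finset.sum_div]
      refine Finset.sum_congr rfl fun j _ => ?_
      simp only [PiLp.add_apply, PiLp.smul_apply, smul_eq_mul]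
      rw [show t i + s * u i + (t j + s * u j) = t i + t j + s * (u i + u j) by ring,
        show t i + s * u i - (t j + s * u j) = t i - t j + s * (u i - u j) by ring]
      ring
    · refine Finset.sum_congr rfl fun i _ => ?_
      simp only [PiLp.add_apply, PiLp.smul_apply, smul_eq_mul]
      rw [show 2 * (t i + s * u i) = 2 * t i + s * (2 * u i) by ring]
      ring
  · congr 1
    rw [logWeightQuad, neg_div, add_div, neg_add, Finset.sum_div, Finset.sum_div,
      ← Finset.sum_neg_distrib, ← Finset.sum_neg_distrib]
    congr 1
    · refine Finset.sum_congr rfl fun i _ => ?_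
      rw [Finset.sum_div, ← Finset.sum_neg_distrib]
      exact Finset.sum_congr rfl fun j _ => by ring
    · exact Finset.sum_congr rfl fun i _ => by ring

/-- A maximizer of `logWeight` in the open alcove is a critical point. -/
theorem logWeightDeriv_eq_zero {a b : ℝ} {t : EuclideanSpace ℝ (Fin N)}
    (ht : t ∈ openAlcove N) (hmax : ∀ t' ∈ openAlcove N, logWeight a b t' ≤ logWeight a b t)
    (u : EuclideanSpace ℝ (Fin N)) : logWeightDeriv a b t u = 0 := by
  have hcont : Tendsto (fun s : ℝ => t + s • u) (𝓝[≠] 0) (𝓝 t) := by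
    have : Tendsto (fun s : ℝ => t + s • u) (𝓝 0) (𝓝 (t + (0 : ℝ) • u)) :=
      Continuous.tendsto (by fun_prop) 0
    rw [zero_smul, add_zero] at this
    exact this.mono_left nhdsWithin_le_nhds
  have hev : ∀ᶠ s : ℝ in 𝓝[≠] 0, t + s • u ∈ openAlcove N :=
    hcont.eventually (isOpen_openAlcove.mem_nhds ht)
  have hid : Tendsto (fun s : ℝ => s) (𝓝[≠] 0) (𝓝 0) := tendsto_id.mono_left nhdsWithin_le_nhds
  -- Multiplying the second-order quotient by s leaves the first-order one; at a maximum its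
  -- one-sided limits have opposite signs.
  have h1 := (logWeight_expansion a b ht u).mul hid
  rw [mul_zero] at h1
  have h2 : Tendsto (fun s : ℝ => (logWeight a b (t + s • u) - logWeight a b t) / s) (𝓝[≠] 0)
      (𝓝 (logWeightDeriv a b t u)) := by
    have h3 := h1.add_const (logWeightDeriv a b t u)
    rw [zero_add] at h3
    refine h3.congr' ?_
    filter_upwards [self_mem_nhdsWithin] with s hs
    have hs' : s ≠ 0 := hs
    field_simp
    ring
  have hpos : 𝓝[>] (0 : ℝ) ≤ 𝓝[≠] 0 := nhdsWithin_mono 0 fun s (hs : 0 < s) => hs.ne'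
  have hneg : 𝓝[<] (0 : ℝ) ≤ 𝓝[≠] 0 := nhdsWithin_mono 0 fun s (hs : s < 0) => hs.ne
  apply le_antisymm
  · refine le_of_tendsto (h2.mono_left hpos) ?_
    filter_upwards [hpos hev, self_mem_nhdsWithin] with s hs hs0
    exact div_nonpos_of_nonpos_of_nonneg (sub_nonpos.2 (hmax _ hs)) (le_of_lt hs0)
  · refine ge_of_tendsto (h2.mono_left hneg) ?_
    filter_upwards [hneg hev, self_mem_nhdsWithin] with s hs hs0
    exact div_nonneg_of_nonpos (sub_nonpos.2 (hmax _ hs)) (le_of_lt hs0)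

end Potential

end BetaJacobi

namespace BetaJacobi

/-! ### Critical points and the Hessian in the coordinates cos 2t. -/

section CriticalPoint

variable {N : ℕ}

theorem sum_Ioi_add_swap (f : Fin N → Fin N → ℝ) :
    ∑ i, ∑ j ∈ Finset.Ioi i, (f i j + f j i) = ∑ i, ∑ j ∈ Finset.univ.erase i, f i j := by
  have := Finset.sum_sum_Ioi_add_eq_sum_sum_off_diag fun j i => f i j
  simpa only [Finset.compl_singleton] using this

/-- The coordinates `z = cos 2t`. -/
noncomputable def cosTwo (t : EuclideanSpace ℝ (Fin N)) : Fin N → ℝ := fun i => Real.cos (2 * t i)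

theorem cosTwo_strictMono {t : EuclideanSpace ℝ (Fin N)} (ht : t ∈ openAlcove N) :
    StrictMono (cosTwo t) := fun i j hij =>
  Real.strictAntiOn_cos (Set.Ioo_subset_Icc_self (mem_Ioo_of_mem_openAlcove ht j).2)
    (Set.Ioo_subset_Icc_self (mem_Ioo_of_mem_openAlcove ht i).2)
    (by linarith [ht.2 i j hij])

theorem cosTwo_mem_Ioo {t : EuclideanSpace ℝ (Fin N)} (ht : t ∈ openAlcove N) (i : Fin N) :
    cosTwo t i ∈ Set.Ioo (-1 : ℝ) 1 := by
  obtain ⟨h1, h2⟩ := (mem_Ioo_of_mem_openAlcove ht i).2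
  have hs := Real.sin_pos_of_pos_of_lt_pi h1 h2
  have := Real.sin_sq_add_cos_sq (2 * t i)
  simp only [cosTwo]
  constructor <;> nlinarith

theorem trigPoint_cosTwo {t : EuclideanSpace ℝ (Fin N)} (ht : t ∈ openAlcove N) :
    trigPoint (cosTwo t) = t := by
  ext i
  obtain ⟨h1, h2⟩ := (mem_Ioo_of_mem_openAlcove ht i).2
  simp only [trigPoint, cosTwo]
  rw [Real.arccos_cos h1.le h2.le]
  ring

theorem sin_add_mul_sin_sub (A B : ℝ) :
    Real.sin (A + B) * Real.sin (A - B) = -(Real.cos (2 * A) - Real.cos (2 * B)) / 2 := by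
  rw [Real.cos_sub_cos, show (2 * A + 2 * B) / 2 = A + B by ring,
    show (2 * A - 2 * B) / 2 = A - B by ring]
  ring

theorem sin_sq_eq_cos_two (A : ℝ) : Real.sin A ^ 2 = (1 - Real.cos (2 * A)) / 2 := by
  rw [Real.sin_sq_eq_half_sub]; ring

theorem sin_two_sq (A : ℝ) : Real.sin (2 * A) ^ 2 = (1 - Real.cos (2 * A)) * (1 + Real.cos (2 * A)) := by
  linear_combination Real.sin_sq_add_cos_sq (2 * A)

theorem sin_add_sin_sub_ne_zero {t : EuclideanSpace ℝ (Fin N)} (ht : t ∈ openAlcove N)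
    {i l : Fin N} (hl : l ≠ i) : cosTwo t i - cosTwo t l ≠ 0 ∧
      Real.sin (t i + t l) ≠ 0 ∧ Real.sin (t i - t l) ≠ 0 := by
  have h1 : cosTwo t i - cosTwo t l ≠ 0 :=
    sub_ne_zero.2 fun h => hl ((cosTwo_strictMono ht).injective h).symm
  have h2 := sin_add_mul_sin_sub (t i) (t l)
  have h3 : Real.sin (t i + t l) * Real.sin (t i - t l) ≠ 0 := by
    rw [h2]; exact div_ne_zero (neg_ne_zero.2 h1) two_ne_zero
  exact ⟨h1, left_ne_zero_of_mul h3, right_ne_zero_of_mul h3⟩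

/-- Over a common denominator the numerator is sin((t_i + t_l) + (t_i - t_l)) and the denominator is
half a difference of cosines. -/
theorem cot_add_cot {t : EuclideanSpace ℝ (Fin N)} (ht : t ∈ openAlcove N)
    {i l : Fin N} (hl : l ≠ i) :
    Real.cos (t i + t l) / Real.sin (t i + t l) + Real.cos (t i - t l) / Real.sin (t i - t l) =
      -Real.sin (2 * t i) * (2 / (cosTwo t i - cosTwo t l)) := by
  obtain ⟨h1, h2, h3⟩ := sin_add_sin_sub_ne_zero ht hl
  have h4 := sin_add_mul_sin_sub (t i) (t l)
  have h5 : Real.sin (2 * t i) = Real.sin (t i + t l) * Real.cos (t i - t l) +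
      Real.cos (t i + t l) * Real.sin (t i - t l) := by
    rw [← Real.sin_add]; congr 1; ring
  rw [div_add_div _ _ h2 h3, h4, h5]
  simp only [cosTwo] at h1 ⊢
  field_simp
  ring

theorem logWeightDeriv_eq_sum (a b : ℝ) (t u : EuclideanSpace ℝ (Fin N)) :
    logWeightDeriv a b t u = ∑ i, u i * (∑ l ∈ Finset.univ.erase i,
      (Real.cos (t i + t l) / Real.sin (t i + t l) + Real.cos (t i - t l) / Real.sin (t i - t l)) +
      (a * (Real.cos (t i) / Real.sin (t i)) +
        2 * b * (Real.cos (2 * t i) / Real.sin (2 * t i)))) := by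
  rw [Finset.sum_congr rfl fun i _ => mul_add (u i) (Finset.sum _ _) _, Finset.sum_add_distrib,
    logWeightDeriv]
  congr 1
  · simp only [Finset.mul_sum]
    rw [← sum_Ioi_add_swap]
    refine Finset.sum_congr rfl fun i _ => Finset.sum_congr rfl fun j _ => ?_
    rw [add_comm (t j), ← neg_sub (t i) (t j), Real.cos_neg, Real.sin_neg, div_neg]
    ring
  · exact Finset.sum_congr rfl fun i _ => by ring

/-- The Stieltjes relations at a critical point of `logWeight`. -/
theorem stieltjes_of_critical {a b : ℝ} {t : EuclideanSpace ℝ (Fin N)} (ht : t ∈ openAlcove N)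
    (hcrit : ∀ u, logWeightDeriv a b t u = 0) (i : Fin N) :
    ∑ l ∈ Finset.univ.erase i, 2 / (cosTwo t i - cosTwo t l) =
      (a + b) / (1 - cosTwo t i) - b / (1 + cosTwo t i) := by
  -- In the i-th coordinate direction every term carries a factor sin 2t_i, which is nonzero and
  -- gets cancelled.
  have h := hcrit (EuclideanSpace.single i 1)
  rw [logWeightDeriv_eq_sum, Finset.sum_eq_single i (by
    intro j _ hj
    simp [hj]) (by simp), Finset.sum_congr rfl fun l hl =>
      cot_add_cot ht (Finset.ne_of_mem_erase hl), ← Finset.mul_sum] at h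
  simp only [PiLp.single_apply, if_true, one_mul] at h
  have hm := cosTwo_mem_Ioo ht i
  have h1 : 1 - cosTwo t i ≠ 0 := by linarith [hm.2]
  have h2 : 1 + cosTwo t i ≠ 0 := by linarith [hm.1]
  have hs : Real.sin (t i) ≠ 0 :=
    (Real.sin_pos_of_mem_Ioo (mem_Ioo_of_mem_openAlcove ht i).1).ne'
  have hs2 : Real.sin (2 * t i) ≠ 0 :=
    (Real.sin_pos_of_mem_Ioo (mem_Ioo_of_mem_openAlcove ht i).2).ne'
  have e1 := sin_sq_eq_cos_two (t i)
  have e2 := sin_two_sq (t i)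
  have e3 := Real.sin_two_mul (t i)
  have hc : Real.cos (t i) ≠ 0 := by
    intro h0; rw [h0] at e3; simp at e3; exact hs2 e3
  generalize ∑ l ∈ Finset.univ.erase i, 2 / (cosTwo t i - cosTwo t l) = Sg at h ⊢
  have f1 : Real.cos (t i) / Real.sin (t i) = Real.sin (2 * t i) / (1 - cosTwo t i) := by
    rw [div_eq_div_iff hs h1, e3]
    simp only [cosTwo]
    linear_combination (-2 * Real.cos (t i)) * e1
  have f2 : Real.cos (2 * t i) / Real.sin (2 * t i) =
      Real.sin (2 * t i) * (cosTwo t i / ((1 - cosTwo t i) * (1 + cosTwo t i))) := by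
    rw [show (1 - cosTwo t i) * (1 + cosTwo t i) = Real.sin (2 * t i) ^ 2 from e2.symm, cosTwo]
    field_simp
  rw [f1, f2] at h
  apply mul_left_cancel₀ hs2
  have h3 : Real.sin (2 * t i) * Sg = a * (Real.sin (2 * t i) / (1 - cosTwo t i)) +
      2 * b * (Real.sin (2 * t i) * (cosTwo t i / ((1 - cosTwo t i) * (1 + cosTwo t i)))) := by
    linarith
  rw [h3]
  field_simp
  ring

theorem logWeightQuad_eq_sum (a b : ℝ) (t u : EuclideanSpace ℝ (Fin N)) :
    logWeightQuad a b t u = ∑ i, u i * (∑ l ∈ Finset.univ.erase i,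
      (u i * (1 / Real.sin (t i + t l) ^ 2 + 1 / Real.sin (t i - t l) ^ 2) +
        u l * (1 / Real.sin (t i + t l) ^ 2 - 1 / Real.sin (t i - t l) ^ 2)) +
      (a / Real.sin (t i) ^ 2 + 4 * b / Real.sin (2 * t i) ^ 2) * u i) := by
  rw [Finset.sum_congr rfl fun i _ => mul_add (u i) (Finset.sum _ _) _, Finset.sum_add_distrib]
  rw [logWeightQuad]
  congr 1
  · simp only [Finset.mul_sum]
    rw [← sum_Ioi_add_swap]
    refine Finset.sum_congr rfl fun i _ => Finset.sum_congr rfl fun j _ => ?_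
    rw [add_comm (t j), ← neg_sub (t i) (t j), Real.sin_neg]
    ring
  · exact Finset.sum_congr rfl fun i _ => by ring

/-- The numerator 1 - z_i z_l splits as (1 - z_i²) + z_i(z_i - z_l); the second part gives simple
fractions that the Stieltjes relation can sum. -/
theorem inv_sin_sq_add {t : EuclideanSpace ℝ (Fin N)} (ht : t ∈ openAlcove N)
    {i l : Fin N} (hl : l ≠ i) :
    1 / Real.sin (t i + t l) ^ 2 + 1 / Real.sin (t i - t l) ^ 2 =
      4 * ((1 - cosTwo t i ^ 2) / (cosTwo t i - cosTwo t l) ^ 2) +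
        2 * cosTwo t i * (2 / (cosTwo t i - cosTwo t l)) := by
  obtain ⟨h1, h2, h3⟩ := sin_add_sin_sub_ne_zero ht hl
  have h4 := sin_add_mul_sin_sub (t i) (t l)
  have h5 : Real.sin (t i + t l) ^ 2 + Real.sin (t i - t l) ^ 2 = 1 - cosTwo t i * cosTwo t l := by
    rw [sin_sq_eq_cos_two, sin_sq_eq_cos_two, cosTwo, cosTwo, mul_add, mul_sub, Real.cos_add,
      Real.cos_sub]
    ring
  rw [div_add_div _ _ (pow_ne_zero 2 h2) (pow_ne_zero 2 h3), ← mul_pow, h4,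
    show 1 * Real.sin (t i - t l) ^ 2 + Real.sin (t i + t l) ^ 2 * 1 =
      1 - cosTwo t i * cosTwo t l by rw [← h5]; ring]
  simp only [cosTwo] at h1 ⊢
  field_simp
  ring

theorem inv_sin_sq_sub {t : EuclideanSpace ℝ (Fin N)} (ht : t ∈ openAlcove N)
    {i l : Fin N} (hl : l ≠ i) (a b : ℝ) :
    1 / Real.sin (t i + t l) ^ 2 - 1 / Real.sin (t i - t l) ^ 2 = invCov a b (cosTwo t) i l := by
  obtain ⟨h1, h2, h3⟩ := sin_add_sin_sub_ne_zero ht hl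
  have h4 := sin_add_mul_sin_sub (t i) (t l)
  have hpos : ∀ j, 0 ≤ Real.sin (2 * t j) := fun j =>
    (Real.sin_pos_of_mem_Ioo (mem_Ioo_of_mem_openAlcove ht j).2).le
  have h6 : √((1 - cosTwo t l ^ 2) * (1 - cosTwo t i ^ 2)) =
      Real.sin (2 * t i) * Real.sin (2 * t l) := by
    rw [← Real.sqrt_sq (mul_nonneg (hpos i) (hpos l)), mul_pow, sin_two_sq, sin_two_sq]
    congr 1
    simp only [cosTwo]
    ring
  have h5 : Real.sin (t i - t l) ^ 2 - Real.sin (t i + t l) ^ 2 =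
      -(Real.sin (2 * t i) * Real.sin (2 * t l)) := by
    rw [sin_sq_eq_cos_two, sin_sq_eq_cos_two, mul_add, mul_sub, Real.cos_add, Real.cos_sub]
    ring
  rw [div_sub_div _ _ (pow_ne_zero 2 h2) (pow_ne_zero 2 h3), ← mul_pow, h4,
    show 1 * Real.sin (t i - t l) ^ 2 - Real.sin (t i + t l) ^ 2 * 1 =
      -(Real.sin (2 * t i) * Real.sin (2 * t l)) by rw [← h5]; ring]
  simp only [invCov, Matrix.of_apply, if_neg hl.symm, h6]
  simp only [cosTwo] at h1 ⊢
  field_simp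
  ring

/-- Off the diagonal the Hessian agrees with the matrix entrywise; on the diagonal, criticality
replaces the sum of simple fractions by the terms in a and b. -/
theorem logWeightQuad_eq_invCov {a b : ℝ} {t : EuclideanSpace ℝ (Fin N)} (ht : t ∈ openAlcove N)
    (hcrit : ∀ u, logWeightDeriv a b t u = 0) (u : EuclideanSpace ℝ (Fin N)) :
    logWeightQuad a b t u = u.ofLp ⬝ᵥ invCov a b (cosTwo t) *ᵥ u.ofLp := by
  rw [logWeightQuad_eq_sum, dotProduct]
  refine Finset.sum_congr rfl fun i _ => ?_
  congr 1
  rw [Matrix.mulVec, dotProduct, ← Finset.add_sum_erase _ _ (Finset.mem_univ i),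
    Finset.sum_add_distrib, ← Finset.mul_sum]
  have hA : ∑ l ∈ Finset.univ.erase i,
      (1 / Real.sin (t i + t l) ^ 2 + 1 / Real.sin (t i - t l) ^ 2) =
      4 * ∑ l ∈ Finset.univ.erase i, (1 - cosTwo t i ^ 2) / (cosTwo t i - cosTwo t l) ^ 2 +
      2 * cosTwo t i * ((a + b) / (1 - cosTwo t i) - b / (1 + cosTwo t i)) := by
    rw [← stieltjes_of_critical ht hcrit i, Finset.mul_sum, Finset.mul_sum,
      ← Finset.sum_add_distrib]
    exact Finset.sum_congr rfl fun l hl => inv_sin_sq_add ht (Finset.ne_of_mem_erase hl)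
  have hB : ∑ l ∈ Finset.univ.erase i,
      u l * (1 / Real.sin (t i + t l) ^ 2 - 1 / Real.sin (t i - t l) ^ 2) =
      ∑ l ∈ Finset.univ.erase i, invCov a b (cosTwo t) i l * u l :=
    Finset.sum_congr rfl fun l hl => by
      rw [inv_sin_sq_sub ht (Finset.ne_of_mem_erase hl) a b, mul_comm]
  rw [hA, hB]
  have hm := cosTwo_mem_Ioo ht i
  have h1 : 1 - cosTwo t i ≠ 0 := by linarith [hm.2]
  have h2 : 1 + cosTwo t i ≠ 0 := by linarith [hm.1]
  have e1 : Real.sin (t i) ^ 2 = (1 - cosTwo t i) / 2 := sin_sq_eq_cos_two (t i)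
  have e2 : Real.sin (2 * t i) ^ 2 = (1 - cosTwo t i) * (1 + cosTwo t i) := sin_two_sq (t i)
  have e3 : invCov a b (cosTwo t) i i = 4 * ∑ l ∈ Finset.univ.erase i,
      (1 - cosTwo t i ^ 2) / (cosTwo t i - cosTwo t l) ^ 2 +
        2 * (a + b) * ((1 + cosTwo t i) / (1 - cosTwo t i)) +
        2 * b * ((1 - cosTwo t i) / (1 + cosTwo t i)) := by
    simp [invCov]
  rw [e1, e2, e3]
  generalize ∑ l ∈ Finset.univ.erase i, (1 - cosTwo t i ^ 2) / (cosTwo t i - cosTwo t l) ^ 2 = A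
  generalize ∑ l ∈ Finset.univ.erase i, invCov a b (cosTwo t) i l * u l = B
  field_simp
  ring

theorem logWeightQuad_pos {a b : ℝ} (ha : 0 ≤ a) (hb : 0 < b) {t : EuclideanSpace ℝ (Fin N)}
    (ht : t ∈ openAlcove N) {u : EuclideanSpace ℝ (Fin N)} (hu : u ≠ 0) :
    0 < logWeightQuad a b t u := by
  refine add_pos_of_nonneg_of_pos (Finset.sum_nonneg fun i _ => Finset.sum_nonneg fun j _ => by
    positivity) ?_
  obtain ⟨i, hi⟩ : ∃ i, u i ≠ 0 := by
    by_contra! h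
    exact hu (by ext i; simpa using h i)
  refine Finset.sum_pos' (fun j _ => by positivity) ⟨i, Finset.mem_univ i, ?_⟩
  have := Real.sin_pos_of_mem_Ioo (mem_Ioo_of_mem_openAlcove ht i).2
  positivity

theorem invCov_posDef {a b : ℝ} (ha : 0 ≤ a) (hb : 0 < b) {t : EuclideanSpace ℝ (Fin N)}
    (ht : t ∈ openAlcove N) (hcrit : ∀ u, logWeightDeriv a b t u = 0) :
    (invCov a b (cosTwo t)).PosDef := by
  refine Matrix.PosDef.of_dotProduct_mulVec_pos ?_ fun x hx => ?_
  · rw [Matrix.IsHermitian, Matrix.conjTranspose_eq_transpose_of_trivial]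
    exact invCov_isSymm a b _
  · have h := logWeightQuad_pos ha hb ht (u := WithLp.toLp 2 x) (by simpa using hx)
    rw [logWeightQuad_eq_invCov ht hcrit] at h
    simpa using h

end CriticalPoint

/-! ### Existence of the critical point and the global Gaussian bound. -/

section Maximizer

variable {N : ℕ}

theorem isCompact_trigAlcove : IsCompact (trigAlcove N) := by
  refine Metric.isCompact_of_isClosed_isBounded ?_ ?_
  · simp only [trigAlcove, Antitone, Set.ofPred_and, Set.ofPred_forall]
    refine IsClosed.inter (isClosed_iInter fun i => IsClosed.inter ?_ ?_)
      (isClosed_iInter fun i => isClosed_iInter fun j => isClosed_iInter fun _ => ?_)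
    all_goals exact isClosed_le (by fun_prop) (by fun_prop)
  · refine (Metric.isBounded_iff_subset_closedBall 0).2 ⟨√(∑ _i : Fin N, (Real.pi / 2) ^ 2), ?_⟩
    intro t ht
    rw [mem_closedBall_zero_iff, EuclideanSpace.norm_eq]
    refine Real.sqrt_le_sqrt (Finset.sum_le_sum fun i _ => ?_)
    rw [Real.norm_eq_abs, sq_abs]
    exact pow_le_pow_left₀ (ht.1 i).1 (ht.1 i).2 2

theorem continuous_trigWeight {k₁ k₂ k₃ : ℝ} (h₁ : 0 ≤ k₁) (h₂ : 0 ≤ k₂) (h₃ : 0 ≤ k₃) :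
    Continuous (trigWeight (N := N) k₁ k₂ k₃) := by
  unfold trigWeight
  refine Continuous.mul (continuous_finsetProd _ fun i _ => continuous_finsetProd _ fun j _ => ?_)
    (continuous_finsetProd _ fun i _ => Continuous.mul ?_ ?_)
  · exact Continuous.rpow_const (by fun_prop) fun _ => Or.inr h₃
  · exact Continuous.rpow_const (by fun_prop) fun _ => Or.inr h₁
  · exact Continuous.rpow_const (by fun_prop) fun _ => Or.inr h₂

theorem bases_nonneg {t : EuclideanSpace ℝ (Fin N)} (ht : t ∈ trigAlcove N) :
    (∀ i, ∀ j ∈ Finset.Ioi i, 0 ≤ Real.cos (2 * t j) - Real.cos (2 * t i)) ∧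
      ∀ i, 0 ≤ Real.sin (t i) ∧ 0 ≤ Real.sin (2 * t i) := by
  refine ⟨fun i j hj => ?_, fun i => ⟨?_, ?_⟩⟩
  · have h1 := ht.1 i
    have h2 := ht.1 j
    have h3 := ht.2 (Finset.mem_Ioi.1 hj).le
    exact sub_nonneg.2 (Real.cos_le_cos_of_nonneg_of_le_pi (by linarith) (by linarith)
      (by simp only at h3; linarith))
  · exact Real.sin_nonneg_of_nonneg_of_le_pi (ht.1 i).1 (by linarith [(ht.1 i).2, Real.pi_pos])
  · exact Real.sin_nonneg_of_nonneg_of_le_pi (by linarith [(ht.1 i).1]) (by linarith [(ht.1 i).2])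

theorem trigWeight_nonneg (k₁ k₂ k₃ : ℝ) {t : EuclideanSpace ℝ (Fin N)} (ht : t ∈ trigAlcove N) :
    0 ≤ trigWeight k₁ k₂ k₃ t := by
  obtain ⟨h1, h2⟩ := bases_nonneg ht
  exact mul_nonneg (Finset.prod_nonneg fun i _ => Finset.prod_nonneg fun j hj =>
    Real.rpow_nonneg (h1 i j hj) _) (Finset.prod_nonneg fun i _ =>
      mul_nonneg (Real.rpow_nonneg (h2 i).1 _) (Real.rpow_nonneg (h2 i).2 _))

theorem trigWeight_mul (a b κ : ℝ) {t : EuclideanSpace ℝ (Fin N)} (ht : t ∈ trigAlcove N) :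
    trigWeight (κ * a) (κ * b) κ t = trigWeight a b 1 t ^ κ := by
  obtain ⟨h1, h2⟩ := bases_nonneg ht
  have h3 : ∀ i ∈ Finset.univ, ∀ j ∈ Finset.Ioi i,
      0 ≤ (Real.cos (2 * t j) - Real.cos (2 * t i)) ^ (1 : ℝ) := fun i _ j hj =>
    Real.rpow_nonneg (h1 i j hj) _
  have h4 : ∀ i ∈ Finset.univ, 0 ≤ Real.sin (t i) ^ a * Real.sin (2 * t i) ^ b := fun i _ =>
    mul_nonneg (Real.rpow_nonneg (h2 i).1 _) (Real.rpow_nonneg (h2 i).2 _)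
  rw [trigWeight, trigWeight, Real.mul_rpow (Finset.prod_nonneg fun i hi =>
    Finset.prod_nonneg (h3 i hi)) (Finset.prod_nonneg h4),
    ← Real.finsetProd_rpow _ _ fun i hi => Finset.prod_nonneg (h3 i hi),
    ← Real.finsetProd_rpow _ _ h4]
  congr 1
  · refine Finset.prod_congr rfl fun i hi => ?_
    rw [← Real.finsetProd_rpow _ _ (h3 i hi)]
    refine Finset.prod_congr rfl fun j hj => ?_
    rw [Real.rpow_one]
  · refine Finset.prod_congr rfl fun i hi => ?_
    rw [Real.mul_rpow (Real.rpow_nonneg (h2 i).1 _) (Real.rpow_nonneg (h2 i).2 _),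
      ← Real.rpow_mul (h2 i).1, ← Real.rpow_mul (h2 i).2, mul_comm a, mul_comm b]

/-- For b > 0 the factor sin(2t_i)^b vanishes at both ends 0 and π/2, and the pair factors vanish
where coordinates coincide. -/
theorem mem_openAlcove_of_trigWeight_ne_zero {a b : ℝ} (hb : 0 < b)
    {t : EuclideanSpace ℝ (Fin N)} (ht : t ∈ trigAlcove N) (h : trigWeight a b 1 t ≠ 0) :
    t ∈ openAlcove N := by
  rw [trigWeight, mul_ne_zero_iff, Finset.prod_ne_zero_iff, Finset.prod_ne_zero_iff] at h
  obtain ⟨h1, h2⟩ := h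
  constructor
  · intro i
    have h3 : Real.sin (2 * t i) ≠ 0 := by
      intro h0
      refine h2 i (Finset.mem_univ i) ?_
      rw [h0, Real.zero_rpow hb.ne', mul_zero]
    refine ⟨lt_of_le_of_ne (ht.1 i).1 fun h0 => h3 ?_, lt_of_le_of_ne (ht.1 i).2 fun h0 => h3 ?_⟩
    · rw [← h0]; simp
    · rw [h0, mul_div_cancel₀ _ two_ne_zero, Real.sin_pi]
  · intro i j hij
    refine lt_of_le_of_ne (ht.2 hij.le) fun h0 => ?_
    have h3 := Finset.prod_ne_zero_iff.1 (h1 i (Finset.mem_univ i)) j (Finset.mem_Ioi.2 hij)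
    simp only at h0
    rw [h0, sub_self, Real.zero_rpow one_ne_zero] at h3
    exact h3 rfl

theorem trigWeight_pos {a b : ℝ} {t : EuclideanSpace ℝ (Fin N)} (ht : t ∈ openAlcove N) :
    0 < trigWeight a b 1 t := by
  rw [trigWeight_eq_exp ht]
  exact mul_pos (Finset.prod_pos fun i _ => Finset.prod_pos fun j _ => two_pos) (Real.exp_pos _)

theorem exists_critical_point {a b : ℝ} (ha : 0 ≤ a) (hb : 0 < b) :
    ∃ t ∈ openAlcove N, ∀ u, logWeightDeriv a b t u = 0 := by
  obtain ⟨t₁, ht₁⟩ := openAlcove_nonempty (N := N)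
  obtain ⟨t, ht, hmax⟩ := isCompact_trigAlcove.exists_isMaxOn ⟨t₁, openAlcove_subset ht₁⟩
    (continuous_trigWeight ha hb.le zero_le_one).continuousOn
  have hpos : 0 < trigWeight a b 1 t :=
    (trigWeight_pos ht₁).trans_le (hmax (openAlcove_subset ht₁))
  have hto := mem_openAlcove_of_trigWeight_ne_zero hb ht hpos.ne'
  refine ⟨t, hto, logWeightDeriv_eq_zero hto fun t' ht' => ?_⟩
  have h1 : trigWeight a b 1 t' ≤ trigWeight a b 1 t := hmax (openAlcove_subset ht')
  rw [trigWeight_eq_exp ht', trigWeight_eq_exp hto] at h1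
  exact Real.exp_le_exp.1 (le_of_mul_le_mul_left h1
    (Finset.prod_pos fun i _ => Finset.prod_pos fun j _ => two_pos))

theorem trigWeight_div_le {a b : ℝ} (ha : 0 ≤ a) (hb : 0 < b) {t₀ t : EuclideanSpace ℝ (Fin N)}
    (ht₀ : t₀ ∈ openAlcove N) (hcrit : ∀ u, logWeightDeriv a b t₀ u = 0)
    (ht : t ∈ trigAlcove N) :
    trigWeight a b 1 t / trigWeight a b 1 t₀ ≤ Real.exp (-(2 * b) * ‖t - t₀‖ ^ 2) := by
  by_cases h : t ∈ openAlcove N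
  · rw [trigWeight_eq_exp h, trigWeight_eq_exp ht₀, mul_div_mul_left _ _
      (Finset.prod_pos fun i _ => Finset.prod_pos fun j _ => two_pos).ne', ← Real.exp_sub]
    refine Real.exp_le_exp.2 ?_
    have := logWeight_le ha hb ht₀ h
    rw [hcrit] at this
    linarith
  · rw [not_imp_comm.1 (mem_openAlcove_of_trigWeight_ne_zero hb ht) h, zero_div]
    exact (Real.exp_pos _).le

end Maximizer

end BetaJacobi

namespace BetaJacobi

/-! ### Densities of Gaussian measures. -/

section GaussianDensity

variable {ι : Type*} [Fintype ι]

theorem integral_cexp_neg_half_sq_add (t : EuclideanSpace ℝ ι) :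
    ∫ v : EuclideanSpace ℝ ι, Complex.exp (inner ℝ v t * Complex.I) *
        (Real.exp (-‖v‖ ^ 2 / 2) : ℂ) =
      ((∫ v : EuclideanSpace ℝ ι, Real.exp (-‖v‖ ^ 2 / 2) : ℝ) : ℂ) *
        Complex.exp (-‖t‖ ^ 2 / 2) := by
  have h0 := GaussianFourier.integral_cexp_neg_mul_sq_norm_add (V := EuclideanSpace ℝ ι)
    (b := 1 / 2) (by norm_num) 0 0
  have h1 := GaussianFourier.integral_cexp_neg_mul_sq_norm_add (V := EuclideanSpace ℝ ι)
    (b := 1 / 2) (by norm_num) Complex.I t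
  have e0 : ((∫ v : EuclideanSpace ℝ ι, Real.exp (-‖v‖ ^ 2 / 2) : ℝ) : ℂ) =
      ∫ v : EuclideanSpace ℝ ι, Complex.exp (-(1 / 2) * ‖v‖ ^ 2 + 0 * (inner ℝ 0 v : ℝ)) := by
    rw [← integral_complex_ofReal]
    refine integral_congr_ae (Eventually.of_forall fun v => ?_)
    simp only
    push_cast
    congr 1
    ring
  have e1 : ∫ v : EuclideanSpace ℝ ι, Complex.exp (inner ℝ v t * Complex.I) *
        (Real.exp (-‖v‖ ^ 2 / 2) : ℂ) =
      ∫ v : EuclideanSpace ℝ ι,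
        Complex.exp (-(1 / 2) * ‖v‖ ^ 2 + Complex.I * (inner ℝ t v : ℝ)) := by
    refine integral_congr_ae (Eventually.of_forall fun v => ?_)
    simp only
    push_cast
    rw [← Complex.exp_add, real_inner_comm]
    congr 1
    ring
  rw [e0, e1, h0, h1, mul_assoc, ← Complex.exp_add]
  congr 2
  rw [Complex.I_sq]
  simp
  ring

theorem integrable_exp_neg_half_sq :
    Integrable fun v : EuclideanSpace ℝ ι => Real.exp (-‖v‖ ^ 2 / 2) := by
  have h := (GaussianFourier.integrable_cexp_neg_mul_sq_norm_add (V := EuclideanSpace ℝ ι)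
    (b := 1 / 2) (by norm_num) 0 0).norm
  refine h.congr (Eventually.of_forall fun v => ?_)
  simp only [Complex.norm_exp]
  congr 1
  simp [← Complex.ofReal_pow]
  ring

/-- Both sides have the same characteristic function. The normalizing integral is never evaluated,
as it cancels later. -/
theorem stdGaussian_eq_withDensity :
    stdGaussian (EuclideanSpace ℝ ι) = volume.withDensity fun v => ENNReal.ofReal
      (Real.exp (-‖v‖ ^ 2 / 2) / ∫ v : EuclideanSpace ℝ ι, Real.exp (-‖v‖ ^ 2 / 2)) := by
  set Z := ∫ v : EuclideanSpace ℝ ι, Real.exp (-‖v‖ ^ 2 / 2) with hZ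
  have hZpos : 0 < Z := integral_exp_pos integrable_exp_neg_half_sq
  have hint := (integrable_exp_neg_half_sq (ι := ι)).div_const Z
  have : IsFiniteMeasure (volume.withDensity fun v : EuclideanSpace ℝ ι =>
      ENNReal.ofReal (Real.exp (-‖v‖ ^ 2 / 2) / Z)) :=
    isFiniteMeasure_withDensity_ofReal hint.2
  refine Measure.ext_of_charFun ?_
  ext t
  rw [charFun_stdGaussian, charFun_apply, integral_withDensity_eq_integral_toReal_smul
    (by fun_prop) (Eventually.of_forall fun _ => ENNReal.ofReal_lt_top)]
  have h1 : ∀ v : EuclideanSpace ℝ ι, (ENNReal.ofReal (Real.exp (-‖v‖ ^ 2 / 2) / Z)).toReal •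
      Complex.exp (inner ℝ v t * Complex.I) =
      (Z : ℂ)⁻¹ * (Complex.exp (inner ℝ v t * Complex.I) * (Real.exp (-‖v‖ ^ 2 / 2) : ℂ)) := by
    intro v
    rw [ENNReal.toReal_ofReal (by positivity), Complex.real_smul]
    push_cast
    ring
  simp_rw [h1]
  rw [integral_const_mul, integral_cexp_neg_half_sq_add, ← mul_assoc, inv_mul_cancel₀, one_mul]
  exact_mod_cast hZpos.ne'

theorem integral_stdGaussian (f : EuclideanSpace ℝ ι → ℝ) :
    (∫ v, f v ∂stdGaussian (EuclideanSpace ℝ ι)) =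
      (∫ v : EuclideanSpace ℝ ι, Real.exp (-‖v‖ ^ 2 / 2))⁻¹ *
        ∫ v, f v * Real.exp (-‖v‖ ^ 2 / 2) := by
  rw [stdGaussian_eq_withDensity, integral_withDensity_eq_integral_toReal_smul
    (by fun_prop) (Eventually.of_forall fun _ => ENNReal.ofReal_lt_top), ← integral_const_mul]
  refine integral_congr_ae (Eventually.of_forall fun v => ?_)
  have hZpos : 0 < ∫ v : EuclideanSpace ℝ ι, Real.exp (-‖v‖ ^ 2 / 2) :=
    integral_exp_pos integrable_exp_neg_half_sq
  simp only
  rw [ENNReal.toReal_ofReal (by positivity), smul_eq_mul]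
  ring

variable [DecidableEq ι]

open scoped MatrixOrder in
/-- The density of the centered normal distribution with covariance matrix `S⁻¹`. -/
theorem integral_multivariateGaussian_inv {S : Matrix ι ι ℝ} (hS : S.PosDef)
    {f : EuclideanSpace ℝ ι → ℝ} (hf : Continuous f) :
    (∫ u : EuclideanSpace ℝ ι, Real.exp (-(u.ofLp ⬝ᵥ S *ᵥ u.ofLp) / 2)) ≠ 0 ∧
    (∫ u, f u ∂multivariateGaussian 0 S⁻¹) =
      (∫ u : EuclideanSpace ℝ ι, Real.exp (-(u.ofLp ⬝ᵥ S *ᵥ u.ofLp) / 2))⁻¹ *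
        ∫ u : EuclideanSpace ℝ ι, f u * Real.exp (-(u.ofLp ⬝ᵥ S *ᵥ u.ofLp) / 2) := by
  -- The target is the image of the standard Gaussian under R; from RSR = 1 the form of S pulls back
  -- along R to the squared norm, and the Jacobian cancels against the normalization.
  set R := CFC.sqrt S⁻¹ with hR
  set M := Matrix.toEuclideanCLM (𝕜 := ℝ) R with hM
  have hRR : R * R = S⁻¹ := CFC.sqrt_mul_sqrt_self _ hS.inv.posSemidef.nonneg
  have hdetS : IsUnit S.det := (Matrix.isUnit_iff_isUnit_det S).1 hS.isUnit
  have hRRS : R * (R * S) = 1 := by rw [← mul_assoc, hRR, Matrix.nonsing_inv_mul _ hdetS]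
  have hRSR : R * S * R = 1 := mul_eq_one_comm.1 hRRS
  have hRT : Rᵀ = R := by
    have := (CFC.sqrt_nonneg S⁻¹).isSelfAdjoint
    rwa [IsSelfAdjoint, Matrix.star_eq_conjTranspose,
      Matrix.conjTranspose_eq_transpose_of_trivial] at this
  have hMv : ∀ v, (M v).ofLp = R *ᵥ v.ofLp := fun v => Matrix.ofLp_toEuclideanCLM R v
  have hquad : ∀ v : EuclideanSpace ℝ ι, (M v).ofLp ⬝ᵥ S *ᵥ (M v).ofLp = ‖v‖ ^ 2 := by
    intro v
    rw [hMv, Matrix.mulVec_mulVec, ← hRT, Matrix.mulVec_transpose, ← Matrix.dotProduct_mulVec,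
      hRT, Matrix.mulVec_mulVec, ← mul_assoc, hRSR, Matrix.one_mulVec,
      EuclideanSpace.real_norm_sq_eq, dotProduct]
    exact Finset.sum_congr rfl fun i _ => by ring
  have hdet : LinearMap.det (M : EuclideanSpace ℝ ι →ₗ[ℝ] EuclideanSpace ℝ ι) ≠ 0 := by
    set M' := Matrix.toEuclideanCLM (𝕜 := ℝ) (R * S) with hM'
    have h1 : M * M' = 1 := by rw [hM, hM', ← map_mul, hRRS, map_one]
    have h2 : (M : EuclideanSpace ℝ ι →ₗ[ℝ] EuclideanSpace ℝ ι) * (M' : _ →ₗ[ℝ] _) = 1 := by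
      ext1 x
      exact congrArg (fun g : EuclideanSpace ℝ ι →L[ℝ] EuclideanSpace ℝ ι => g x) h1
    intro h0
    have h3 := congrArg LinearMap.det h2
    rw [map_mul, h0, zero_mul, map_one] at h3
    exact zero_ne_one h3
  set c := |(LinearMap.det (M : EuclideanSpace ℝ ι →ₗ[ℝ] EuclideanSpace ℝ ι))⁻¹| with hc
  have hcne : c ≠ 0 := abs_ne_zero.2 (inv_ne_zero hdet)
  have hcov : ∀ g : EuclideanSpace ℝ ι → ℝ, Continuous g → ∫ v, g (M v) = c * ∫ u, g u := by
    intro g hg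
    have h1 := Measure.map_linearMap_addHaar_eq_smul_addHaar
      (volume : Measure (EuclideanSpace ℝ ι)) hdet
    rw [← integral_map (φ := M) (by fun_prop) hg.aestronglyMeasurable]
    rw [show (⇑M) = ⇑(M : EuclideanSpace ℝ ι →ₗ[ℝ] EuclideanSpace ℝ ι) from rfl, h1,
      integral_smul_measure, ENNReal.toReal_ofReal (abs_nonneg _), smul_eq_mul]
  have hqc : Continuous fun u : EuclideanSpace ℝ ι =>
      Real.exp (-(u.ofLp ⬝ᵥ S *ᵥ u.ofLp) / 2) := by
    simp only [dotProduct, Matrix.mulVec]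
    fun_prop
  have hZ : (∫ v : EuclideanSpace ℝ ι, Real.exp (-‖v‖ ^ 2 / 2)) =
      c * ∫ u : EuclideanSpace ℝ ι, Real.exp (-(u.ofLp ⬝ᵥ S *ᵥ u.ofLp) / 2) := by
    rw [← hcov _ hqc]
    simp_rw [hquad]
  have hZpos : 0 < ∫ v : EuclideanSpace ℝ ι, Real.exp (-‖v‖ ^ 2 / 2) :=
    integral_exp_pos integrable_exp_neg_half_sq
  refine ⟨fun h => ?_, ?_⟩
  · rw [h, mul_zero] at hZ
    exact hZpos.ne' hZ
  · have hF := hcov (fun u => f u * Real.exp (-(u.ofLp ⬝ᵥ S *ᵥ u.ofLp) / 2)) (hf.mul hqc)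
    simp only [hquad] at hF
    rw [multivariateGaussian, integral_map (by fun_prop) hf.aestronglyMeasurable]
    simp_rw [zero_add]
    rw [integral_stdGaussian, hF, hZ, mul_inv]
    field_simp

end GaussianDensity

end BetaJacobi

namespace BetaJacobi

/-! ### Laplace's method. -/

section Laplace

variable {N : ℕ}

theorem integral_trigJacobiEnsemble {a b κ : ℝ} (ha : 0 ≤ a) (hb : 0 < b) (hκ : 0 < κ)
    (F : EuclideanSpace ℝ (Fin N) → ℝ) :
    ∫ t, F t ∂(trigJacobiEnsemble N (κ * a) (κ * b) κ) =
      (∫ t in trigAlcove N, trigWeight a b 1 t ^ κ)⁻¹ *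
        ∫ t in trigAlcove N, trigWeight a b 1 t ^ κ * F t := by
  have hA : MeasurableSet (trigAlcove N) := isCompact_trigAlcove.measurableSet
  have key : ∀ G : EuclideanSpace ℝ (Fin N) → ℝ,
      ∫ t, G t ∂(trigUnnormalized N (κ * a) (κ * b) κ) =
        ∫ t in trigAlcove N, trigWeight a b 1 t ^ κ * G t := by
    intro G
    rw [trigUnnormalized, integral_withDensity_eq_integral_toReal_smul
      (continuous_trigWeight (by positivity) (by positivity) hκ.le).measurable.ennreal_ofReal
      (Eventually.of_forall fun _ => ENNReal.ofReal_lt_top)]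
    refine setIntegral_congr_fun hA fun t ht => ?_
    rw [ENNReal.toReal_ofReal (trigWeight_nonneg _ _ _ ht), trigWeight_mul _ _ _ ht, smul_eq_mul]
  rw [trigJacobiEnsemble, integral_smul_measure, key, ENNReal.toReal_inv, smul_eq_mul]
  congr 2
  have h1 := key fun _ => 1
  simp only [mul_one, integral_const, smul_eq_mul] at h1
  exact h1

/-- The density of the ensemble relative to its value at `t₀`, extended by zero. -/
noncomputable def relWeight (a b : ℝ) (t₀ : EuclideanSpace ℝ (Fin N)) (κ : ℝ) :
    EuclideanSpace ℝ (Fin N) → ℝ :=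
  (trigAlcove N).indicator fun t => (trigWeight a b 1 t / trigWeight a b 1 t₀) ^ κ

theorem measurable_relWeight {a b : ℝ} (ha : 0 ≤ a) (hb : 0 < b)
    (t₀ : EuclideanSpace ℝ (Fin N)) (κ : ℝ) : Measurable (relWeight a b t₀ κ) :=
  (((continuous_trigWeight ha hb.le zero_le_one).measurable.div_const _).pow_const κ).indicator
    isCompact_trigAlcove.measurableSet

theorem setIntegral_trigWeight_rpow {a b : ℝ} {t₀ : EuclideanSpace ℝ (Fin N)}
    (ht₀ : t₀ ∈ openAlcove N) (κ : ℝ) (F : EuclideanSpace ℝ (Fin N) → ℝ) :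
    ∫ t in trigAlcove N, trigWeight a b 1 t ^ κ * F t =
      trigWeight a b 1 t₀ ^ κ * ∫ t, F t * relWeight a b t₀ κ t := by
  rw [← integral_const_mul, ← integral_indicator isCompact_trigAlcove.measurableSet]
  refine integral_congr_ae (Eventually.of_forall fun t => ?_)
  by_cases ht : t ∈ trigAlcove N
  · simp only [Set.indicator_of_mem ht, relWeight]
    have h0 := trigWeight_pos (a := a) (b := b) ht₀
    rw [Real.div_rpow (trigWeight_nonneg _ _ _ ht) h0.le]
    have := (Real.rpow_pos_of_pos h0 κ).ne'
    field_simp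
  · simp [Set.indicator_of_notMem ht, relWeight]

theorem integral_rescaled {κ : ℝ} (hκ : 0 < κ) (t₀ : EuclideanSpace ℝ (Fin N))
    (F h : EuclideanSpace ℝ (Fin N) → ℝ) :
    ∫ t, F (√κ • (t - t₀)) * h t =
      |(√κ ^ Module.finrank ℝ (EuclideanSpace ℝ (Fin N)))⁻¹| *
        ∫ u, F u * h (t₀ + (√κ)⁻¹ • u) := by
  have h1 := Measure.integral_comp_smul (volume : Measure (EuclideanSpace ℝ (Fin N)))
    (fun u => F u * h (t₀ + (√κ)⁻¹ • u)) √κ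
  rw [smul_eq_mul] at h1
  rw [← h1, ← integral_add_right_eq_self (fun t => F (√κ • (t - t₀)) * h t) t₀]
  refine integral_congr_ae (Eventually.of_forall fun t => ?_)
  simp only
  rw [inv_smul_smul₀ (Real.sqrt_pos.2 hκ).ne', add_sub_cancel_right, add_comm]

/-- The peak value to the power `κ` and the Jacobian of the rescaling both occur in numerator and
normalization and cancel. -/
theorem integral_trigJacobiEnsemble_rescaled {a b κ : ℝ} (ha : 0 ≤ a) (hb : 0 < b) (hκ : 0 < κ)
    {t₀ : EuclideanSpace ℝ (Fin N)} (ht₀ : t₀ ∈ openAlcove N)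
    (F : EuclideanSpace ℝ (Fin N) → ℝ) :
    ∫ t, F (√κ • (t - t₀)) ∂(trigJacobiEnsemble N (κ * a) (κ * b) κ) =
      (∫ u, relWeight a b t₀ κ (t₀ + (√κ)⁻¹ • u))⁻¹ *
        ∫ u, F u * relWeight a b t₀ κ (t₀ + (√κ)⁻¹ • u) := by
  have h1 := setIntegral_trigWeight_rpow (a := a) (b := b) ht₀ κ fun _ => 1
  have h2 := setIntegral_trigWeight_rpow (a := a) (b := b) ht₀ κ fun t => F (√κ • (t - t₀))
  have h3 := integral_rescaled hκ t₀ (fun _ => 1) (relWeight a b t₀ κ)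
  simp only [mul_one, one_mul] at h1 h3
  rw [integral_trigJacobiEnsemble ha hb hκ, h1, h2, h3, integral_rescaled hκ]
  have e1 := (Real.rpow_pos_of_pos (trigWeight_pos (a := a) (b := b) ht₀) κ).ne'
  have e2 : |(√κ ^ Module.finrank ℝ (EuclideanSpace ℝ (Fin N)))⁻¹| ≠ 0 :=
    abs_ne_zero.2 (inv_ne_zero (pow_ne_zero _ (Real.sqrt_pos.2 hκ).ne'))
  rw [mul_inv, mul_inv]
  field_simp

/-- Since ‖t - t₀‖² = ‖u‖²/κ, the `κ`-th power of the Gaussian bound no longer depends on `κ`. -/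
theorem relWeight_rescaled_le {a b κ : ℝ} (ha : 0 ≤ a) (hb : 0 < b) (hκ : 0 < κ)
    {t₀ : EuclideanSpace ℝ (Fin N)} (ht₀ : t₀ ∈ openAlcove N)
    (hcrit : ∀ u, logWeightDeriv a b t₀ u = 0) (u : EuclideanSpace ℝ (Fin N)) :
    |relWeight a b t₀ κ (t₀ + (√κ)⁻¹ • u)| ≤ Real.exp (-(2 * b) * ‖u‖ ^ 2) := by
  set t := t₀ + (√κ)⁻¹ • u with ht
  by_cases hA : t ∈ trigAlcove N
  · rw [relWeight, Set.indicator_of_mem hA]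
    have h0 : 0 ≤ trigWeight a b 1 t / trigWeight a b 1 t₀ :=
      div_nonneg (trigWeight_nonneg _ _ _ hA) (trigWeight_pos ht₀).le
    rw [abs_of_nonneg (Real.rpow_nonneg h0 κ)]
    refine (Real.rpow_le_rpow h0 (trigWeight_div_le ha hb ht₀ hcrit hA) hκ.le).trans (le_of_eq ?_)
    rw [← Real.exp_mul, ht, add_sub_cancel_left, norm_smul, norm_inv,
      Real.norm_of_nonneg (Real.sqrt_nonneg κ), mul_pow, inv_pow, Real.sq_sqrt hκ.le]
    congr 1
    field_simp
  · rw [relWeight, Set.indicator_of_notMem hA, abs_zero]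
    exact (Real.exp_pos _).le

/-- This is the second-order expansion at s = 1/√κ, where multiplying by `κ` is dividing by s². The
indicator is eventually 1 because t₀ is interior. -/
theorem tendsto_relWeight_rescaled {a b : ℝ} {t₀ : EuclideanSpace ℝ (Fin N)}
    (ht₀ : t₀ ∈ openAlcove N) (hcrit : ∀ u, logWeightDeriv a b t₀ u = 0)
    (u : EuclideanSpace ℝ (Fin N)) :
    Tendsto (fun κ : ℝ => relWeight a b t₀ κ (t₀ + (√κ)⁻¹ • u)) atTop
      (𝓝 (Real.exp (-logWeightQuad a b t₀ u / 2))) := by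
  have hs : Tendsto (fun κ : ℝ => (√κ)⁻¹) atTop (𝓝 0) :=
    tendsto_inv_atTop_zero.comp Real.tendsto_sqrt_atTop
  have hs' : Tendsto (fun κ : ℝ => (√κ)⁻¹) atTop (𝓝[≠] 0) :=
    tendsto_nhdsWithin_iff.2 ⟨hs, (eventually_gt_atTop 0).mono fun κ hκ =>
      inv_ne_zero (Real.sqrt_pos.2 hκ).ne'⟩
  have hmem : ∀ᶠ κ : ℝ in atTop, t₀ + (√κ)⁻¹ • u ∈ openAlcove N := by
    have h1 : Tendsto (fun κ : ℝ => t₀ + (√κ)⁻¹ • u) atTop (𝓝 (t₀ + (0 : ℝ) • u)) :=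
      tendsto_const_nhds.add (hs.smul_const u)
    rw [zero_smul, add_zero] at h1
    exact h1.eventually (isOpen_openAlcove.mem_nhds ht₀)
  refine ((Real.continuous_exp.tendsto _).comp
    ((logWeight_expansion a b ht₀ u).comp hs')).congr' ?_
  filter_upwards [hmem, eventually_gt_atTop 0] with κ hκ hκ0
  simp only [Function.comp_apply]
  rw [relWeight, Set.indicator_of_mem (openAlcove_subset hκ), trigWeight_eq_exp hκ,
    trigWeight_eq_exp ht₀, mul_div_mul_left _ _
      (Finset.prod_pos fun i _ => Finset.prod_pos fun j _ => two_pos).ne', ← Real.exp_sub,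
    ← Real.exp_mul, hcrit u, mul_zero, sub_zero, inv_pow, Real.sq_sqrt hκ0.le, div_inv_eq_mul]

theorem tendsto_integral_relWeight {a b : ℝ} (ha : 0 ≤ a) (hb : 0 < b)
    {t₀ : EuclideanSpace ℝ (Fin N)} (ht₀ : t₀ ∈ openAlcove N)
    (hcrit : ∀ u, logWeightDeriv a b t₀ u = 0) {F : EuclideanSpace ℝ (Fin N) → ℝ}
    (hF : Continuous F) {K : ℝ} (hK : ∀ u, |F u| ≤ K) :
    Tendsto (fun κ : ℝ => ∫ u, F u * relWeight a b t₀ κ (t₀ + (√κ)⁻¹ • u)) atTop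
      (𝓝 (∫ u, F u * Real.exp (-logWeightQuad a b t₀ u / 2))) := by
  refine tendsto_integral_filter_of_dominated_convergence
    (fun u => K * Real.exp (-(2 * b) * ‖u‖ ^ 2)) ?_ ?_ ?_ ?_
  · refine Eventually.of_forall fun κ => ?_
    exact (hF.measurable.mul ((measurable_relWeight ha hb t₀ κ).comp
      (by fun_prop))).aestronglyMeasurable
  · filter_upwards [eventually_gt_atTop 0] with κ hκ
    refine Eventually.of_forall fun u => ?_
    rw [Real.norm_eq_abs, abs_mul]
    exact mul_le_mul (hK u) (relWeight_rescaled_le ha hb hκ ht₀ hcrit u) (abs_nonneg _)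
      ((abs_nonneg _).trans (hK u))
  · refine Integrable.const_mul ?_ K
    have h := (GaussianFourier.integrable_cexp_neg_mul_sq_norm_add
      (V := EuclideanSpace ℝ (Fin N)) (b := (2 * b : ℝ)) (by simpa using hb) 0 0).norm
    refine h.congr (Eventually.of_forall fun v => ?_)
    simp only [Complex.norm_exp]
    congr 1
    simp [← Complex.ofReal_pow, ← Complex.ofReal_mul]
  · exact Eventually.of_forall fun u => (tendsto_relWeight_rescaled ht₀ hcrit u).const_mul _

/-- Laplace's method for the β-Jacobi ensembles. -/
theorem tendsto_integral_trigJacobiEnsemble {a b : ℝ} (ha : 0 ≤ a) (hb : 0 < b)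
    {t₀ : EuclideanSpace ℝ (Fin N)} (ht₀ : t₀ ∈ openAlcove N)
    (hcrit : ∀ u, logWeightDeriv a b t₀ u = 0) {F : EuclideanSpace ℝ (Fin N) → ℝ}
    (hF : Continuous F) {K : ℝ} (hK : ∀ u, |F u| ≤ K) :
    Tendsto (fun κ : ℝ =>
        ∫ t, F (√κ • (t - t₀)) ∂(trigJacobiEnsemble N (κ * a) (κ * b) κ)) atTop
      (𝓝 (∫ u, F u ∂multivariateGaussian 0 (invCov a b (cosTwo t₀))⁻¹)) := by
  obtain ⟨hne, hG⟩ := integral_multivariateGaussian_inv (invCov_posDef ha hb ht₀ hcrit) hF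
  have h1 := tendsto_integral_relWeight ha hb ht₀ hcrit hF hK
  have h2 := tendsto_integral_relWeight ha hb ht₀ hcrit (F := fun _ => 1) continuous_const
    (K := 1) (by simp)
  simp only [one_mul] at h2
  simp_rw [← logWeightQuad_eq_invCov ht₀ hcrit] at hne hG
  rw [hG]
  refine ((h2.inv₀ hne).mul h1).congr' ?_
  filter_upwards [eventually_gt_atTop 0] with κ hκ
  rw [integral_trigJacobiEnsemble_rescaled ha hb hκ ht₀]

end Laplace

end BetaJacobi

/-! ### Assembly of the theorem. -/

open BetaJacobi in
theorem theorem2p4 (N : ℕ) (a b : ℝ) (ha : 0 ≤ a) (hb : 0 < b) (α β : ℝ)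
    (hα : α = a + b - 1) (hβ : β = b - 1)
    {Ω : Set.Ioi (0 : ℝ) → Type*} [∀ κ, MeasurableSpace (Ω κ)]
    (P : (κ : Set.Ioi (0 : ℝ)) → Measure (Ω κ)) [∀ κ, IsProbabilityMeasure (P κ)]
    (Xt : (κ : Set.Ioi (0 : ℝ)) → Ω κ → EuclideanSpace ℝ (Fin N))
    (hXt : ∀ κ : Set.Ioi (0 : ℝ),
      HasLaw (Xt κ) (trigJacobiEnsemble N (κ * a) (κ * b) κ) (P κ)) :
    ∃ z : Fin N → ℝ,
      -- `z` is the vector of the ordered zeros, all of them simple and in `(-1, 1)`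
      StrictMono z ∧ (∀ i, z i ∈ Set.Ioo (-1 : ℝ) 1) ∧
      (jacobiPolynomial N α β).roots = Finset.univ.val.map z ∧
      -- the central limit theorem
      (invCov a b z).PosDef ∧
      TendstoInDistribution (fun (κ : Set.Ioi (0 : ℝ)) ω => √(κ : ℝ) • (Xt κ ω - trigPoint z)) atTop id P
        (multivariateGaussian 0 (invCov a b z)⁻¹) ∧
      -- the eigenvalues, with multiplicities, are the distinct positive numbers `λ₁, …, λ_N`
      (∀ k : Fin N, 0 < eigenvalue N α β (k + 1)) ∧
      Function.Injective (fun k : Fin N => eigenvalue N α β (k + 1)) ∧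
      (invCov a b z).charpoly = ∏ k : Fin N, (X - C (eigenvalue N α β (k + 1))) ∧
      -- the eigenvectors
      ∃ q : Fin N → ℝ[X],
        (∀ k : Fin N, (q k).degree = ((k : ℕ) : WithBot ℕ)) ∧
        (∀ k l : Fin N, ∫ x, (q k).eval x * (q l).eval x ∂(discreteMeasure z) =
          if k = l then 1 else 0) ∧
        ∀ k : Fin N, Module.End.HasEigenvector (Matrix.toLin' (invCov a b z))
          (eigenvalue N α β (k + 1)) (eigenvec z (q k)) := by
  subst hα hβ
  obtain ⟨t₀, ht₀, hcrit⟩ := exists_critical_point (N := N) ha hb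
  have hmono := cosTwo_strictMono ht₀
  have hmem := cosTwo_mem_Ioo ht₀
  have hst := stieltjes_of_critical ht₀ hcrit
  have hlt : StrictMono (fun k : Fin N => eigenvalue N (a + b - 1) (b - 1) (k + 1)) :=
    fun j k hjk => eigenvalue_lt_eigenvalue ha hb (Nat.succ_lt_succ hjk) k.2
  obtain ⟨q, hq1, hq2, hq3⟩ := exists_orthonormal_eigenpolynomials ha hb hmono.injective hmem hst
  refine ⟨cosTwo t₀, hmono, hmem, ?_, invCov_posDef ha hb ht₀ hcrit, ?_, ?_, hlt.injective,
    charpoly_eq_prod_of_hasEigenvalue _ hlt.injective fun k =>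
      Module.End.hasEigenvalue_of_hasEigenvector (hq3 k), q, hq1, hq2, hq3⟩
  · refine jacobiPolynomial_roots (by linarith) hmono.injective hmem fun i => ?_
    rw [hst i, sub_add_cancel, sub_add_cancel]
  · rw [trigPoint_cosTwo ht₀]
    have hmeas : ∀ κ : Set.Ioi (0 : ℝ),
        AEMeasurable (fun ω => √(κ : ℝ) • (Xt κ ω - t₀)) (P κ) := fun κ =>
      (show Measurable fun t : EuclideanSpace ℝ (Fin N) => √(κ : ℝ) • (t - t₀) by
        fun_prop).comp_aemeasurable (hXt κ).aemeasurable
    refine ⟨hmeas, aemeasurable_id,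
      ProbabilityMeasure.tendsto_iff_forall_integral_tendsto.2 fun F => ?_⟩
    -- Weak convergence is tested on bounded continuous F; the limit over real `κ` is transferred to
    -- the index type of positive reals.
    have key := (tendsto_comp_val_Ioi_atTop (a := (0 : ℝ))).2
      (tendsto_integral_trigJacobiEnsemble ha hb ht₀ hcrit F.continuous
        (K := ‖F‖) fun u => F.norm_coe_le_norm u)
    simp only [ProbabilityMeasure.coe_mk, Measure.map_id]
    refine key.congr fun κ => ?_
    rw [integral_map (hmeas κ) F.continuous.aestronglyMeasurable]
    exact ((hXt κ).integral_comp (f := fun t => F (√(κ : ℝ) • (t - t₀)))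
      (by fun_prop)).symm
  · intro k
    -- Positivity is the comparison with the value 0 at index 0.
    have := eigenvalue_lt_eigenvalue (N := N) ha hb (Nat.succ_pos k) k.2
    simpa [eigenvalue] using this
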